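/- **Setting.** For integers $a,b,c,x$ and $m\ge 0$ let $$E_m(a,b,c,x)=\sum_{j=\max\{0,x-c+m\}}^{\min\{m,x\}}(-1)^j\binom mj(b-m+1)_j(-x)_j(a-m+1)_{m-j}(x-c)_{m-j},\qquad (x)_r=x(x+1)\cdots(x+r-1).$$ For a finite set $X$ with $|X|=n$ let $M^{n-m,m}(X)$ be the space of complex functions on the $m$-subsets of $X$, with $\langle f,g\rangle=\sum f\overline g$, and for $0\le k\le n/2$ let $S^{n-k,k}(X)$ be the space of all $f\in M^{n-k,k}(X)$ with $\sum_{x\notin C}f(C\cup\{x\})=0$ for every $(k-1)$-subset $C$. Let $\mathcal T$ be a planar binary tree with $h\ge 2$ leaves whose internal vertices all have a left and a right son, let $\mathbf a=(a_1,\dots,a_h)$ be a composition of $n$ into positive parts, attached to the leaves from left to right, let $\mathcal T',\mathcal T''$ be the left and right subtrees of the root, let $t$ be the number of leaves of $\mathcal T'$, $\underline a_t=a_1+\dots+a_t$, $\mathbf a'=(a_1,\dots,a_t)$, $\mathbf a''=(a_{t+1},\dots,a_h)$. A representation labeling $\mathcal T_{\rm r}(\mathbf k)$ assigns a nonnegative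 integer to each internal vertex and $0$ to each leaf so that, at each internal vertex with label $k$, with labels $i$ (left) and $j$ (right) at its sons and with $p$ and $q$ the sums of the parts of $\mathbf a$ below these sons, $$i\le p/2,\quad j\le q/2,\quad k-p\le j-i\le q-k,\quad i+j\le k .$$ From now on $k,i,j$ are the labels of the root and of its left and right son, and $m$ is an integer with $0\le k\le\min\{m,n-m\}$. Let $\Omega_{\mathbf a}(X)$ be the set of ordered partitions $(B_1,\dots,B_h)$ of $X$ with $|B_s|=a_s$, and $M^{\mathbf a}(X)$ the space of complex functions on it; permutations act by $(gf)(x)=f(g^{-1}x)$. Without mention of $X$, $X=\{1,\dots,n\}$. Let $A=(A_1,\dots,A_h)\in\Omega_{\mathbf a}$ be the partition into consecutive intervals, $S_{\mathbf a}$ its stabilizer in $S_n$, and $Y=\{1,\dots,m\}$. *The functions $\Phi$.* For a single leaf of label $a_1$, with block $A_1$, $\Phi(m)$ is the characteristic function of the set of $m$-subsets of $A_1$; recursively $$\Phi(\mathcal T(\mathbf a),m,\mathcal T_{\rm r}(\mathbf k))=\sum_{w=\max\{j,i-\underline a_t+m\}}^{\min\{n-\underline a_t-j,m-i\}}E_{k-i-j}(n-\underline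 a_t-2j,\underline a_t-2i,m-i-j,w-j)\;\Phi(\mathcal T'(\mathbf a),m-w,\mathcal T'_{\rm r}(\mathbf k))\otimes\Phi(\mathcal T''(\mathbf a),w,\mathcal T''_{\rm r}(\mathbf k)),$$ where $(f\otimes g)(C)=f(C\cap A')\,g(C\cap A'')$ with $A'=A_1\cup\dots\cup A_t$, $A''=A_{t+1}\cup\dots\cup A_h$. *The functions $\Psi$.* A variable labeling assigns to each internal vertex an integer. For the space label $m$ at the root it is admissible if the variable $w$ at the root satisfies $\max\{j,i-\underline a_t+m\}\le w\le\min\{n-\underline a_t-j,m-i\}$ and, recursively, its restrictions to $\mathcal T'$ and $\mathcal T''$ are admissible for the space labels $m-w$ and $w$. Put $$E_{\mathcal T}(m,\mathbf w)=E_{k-i-j}(n-\underline a_t-2j,\underline a_t-2i,m-i-j,w-j)\,E_{\mathcal T'}(m-w,\mathbf w')\,E_{\mathcal T''}(w,\mathbf w''),$$ with factor $1$ for a leaf, and let $x_s$ be the space label that the $s$-th leaf receives in this way. For a finite set $X$ with $|X|=n$ and an $m$-subset $Y$ of $X$, $\Psi(\mathcal T(\mathbf a),m,\mathcal T_{\rm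 r}(\mathbf k))\in M^{\mathbf a}(X)$ is the sum over all admissible $\mathbf w$ of $E_{\mathcal T}(m,\mathbf w)$ times the characteristic function of $\{B\in\Omega_{\mathbf a}(X):|B_s\cap Y|=x_s\ \forall s\}$. Moreover $$\Xi(\mathcal T(\mathbf a),w,\mathcal T_{\rm r}(\mathbf k))=\sum_{\substack{|F|=\underline a_t\\ |F\cap Y|=m-w}}\bigl[\Psi(\mathcal T'(\mathbf a),m-w,\mathcal T'_{\rm r}(\mathbf k))\otimes\Psi(\mathcal T''(\mathbf a),w,\mathcal T''_{\rm r}(\mathbf k))\bigr]_F,$$ where the two factors are taken in $M^{\mathbf a'}(F)$ and $M^{\mathbf a''}(F^C)$, for the subsets $F\cap Y$ and $F^C\cap Y$, and their tensor product is extended by zero to $\Omega_{\mathbf a}$. *The spaces $[S^{n-k,k}]_{\mathcal T_{\rm r}(\mathbf k)}$.* For a single leaf, this is the trivial representation $M^{(a_1)}(X)$. For a tree with at least two leaves, let $V'(F)\subseteq M^{\mathbf a'}(F)$ and $V''(F^C)\subseteq M^{\mathbf a''}(F^C)$ be the spaces for $\mathcal T'$ and $\mathcal T''$; then $[S^{n-k,k}]_{\mathcal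 T_{\rm r}(\mathbf k)}$ is the subspace isomorphic to $S^{n-k,k}(X)$ as a representation of the symmetric group of $X$ in the induced representation $$\bigoplus_{F\subseteq X,\ |F|=\underline a_t}V'(F)\otimes V''(F^C)\subseteq M^{\mathbf a}(X).$$ **Statement.** 1. The induced representation (for $X=\{1,\dots,n\}$) contains exactly one subspace isomorphic to $S^{n-k,k}$, so that $[S^{n-k,k}]_{\mathcal T_{\rm r}(\mathbf k)}$ is well defined. 2. The function $v=\Phi(\mathcal T(\mathbf a),k,\mathcal T_{\rm r}(\mathbf k))$ is an $S_{\mathbf a}$-invariant vector of $S^{n-k,k}$, and the linear operator $T_v:S^{n-k,k}\to M^{\mathbf a}$ given by $(T_vu)(gA)=\langle u,gv\rangle$, $g\in S_n$, satisfies $T_vS^{n-k,k}=[S^{n-k,k}]_{\mathcal T_{\rm r}(\mathbf k)}$. 3. $\Psi=\Psi(\mathcal T(\mathbf a),m,\mathcal T_{\rm r}(\mathbf k))$ satisfies $\Psi(gA)=\Phi(\mathcal T(\mathbf a),m,\mathcal T_{\rm r}(\mathbf k))(g^{-1}Y)$ for all $g\in S_n$; it is invariant under the stabilizer $S_{n-m}\times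 S_m$ of $Y$ and belongs to $[S^{n-k,k}]_{\mathcal T_{\rm r}(\mathbf k)}$. 4. For every $w$ in the range of the following sum, $\Xi(\mathcal T(\mathbf a),w,\mathcal T_{\rm r}(\mathbf k))$ vanishes outside $\Theta_w=\{B\in\Omega_{\mathbf a}:|(B_1\cup\dots\cup B_t)\cap Y|=m-w\}$, and $$\Psi(\mathcal T(\mathbf a),m,\mathcal T_{\rm r}(\mathbf k))=\sum_{w=\max\{j,i-\underline a_t+m\}}^{\min\{n-\underline a_t-j,\,m-i\}}E_{k-i-j}(n-\underline a_t-2j,\underline a_t-2i,m-i-j,w-j)\;\Xi(\mathcal T(\mathbf a),w,\mathcal T_{\rm r}(\mathbf k)).$$ -/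

import Mathlib

open scoped Pointwise

noncomputable section

namespace HahnTree

/-! ### One-variable Hahn polynomials -/

/-- The rising factorial `(x)_r = x (x+1) ⋯ (x+r-1)`. -/
def rising (x : ℤ) (r : ℕ) : ℤ := ∏ s ∈ Finset.range r, (x + s)

/-- The Hahn polynomial `E_m(a,b,c,x)` in Dunkl's normalization; the sum is over the integers `j`
with `max {0, x-c+m} ≤ j ≤ min {m, x}`. -/
def hahnE (m : ℕ) (a b c x : ℤ) : ℤ :=
  ∑ j ∈ (Finset.range (m + 1)).filter (fun j : ℕ => x - c + m ≤ (j : ℤ) ∧ (j : ℤ) ≤ x),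
    (-1) ^ j * (m.choose j : ℤ) * rising (b - m + 1) j * rising (-x) j *
      rising (a - m + 1) (m - j) * rising (x - c) (m - j)

/-! ### Planar rooted binary trees and their labelings -/

/-- Planar binary trees: a leaf, or a root with a left and a right subtree. -/
inductive BTree : Type
  | leaf : BTree
  | node : BTree → BTree → BTree

/-- The leaves of a tree (those of the left subtree come before those of the right subtree). -/
def Leaf : BTree → Type
  | .leaf => Unit
  | .node l r => Leaf l ⊕ Leaf r

/-- The internal vertices of a tree; `none` is the root. -/
def Internal : BTree → Type
  | .leaf => Empty
  | .node l r => Option (Internal l ⊕ Internal r)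

instance instFintypeLeaf : (T : BTree) → Fintype (Leaf T)
  | .leaf => inferInstanceAs (Fintype Unit)
  | .node l r =>
    letI := instFintypeLeaf l
    letI := instFintypeLeaf r
    inferInstanceAs (Fintype (Leaf l ⊕ Leaf r))

instance instFintypeInternal : (T : BTree) → Fintype (Internal T)
  | .leaf => inferInstanceAs (Fintype Empty)
  | .node l r =>
    letI := instFintypeInternal l
    letI := instFintypeInternal r
    inferInstanceAs (Fintype (Option (Internal l ⊕ Internal r)))

instance instDecidableEqInternal : (T : BTree) → DecidableEq (Internal T)
  | .leaf => inferInstanceAs (DecidableEq Empty)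
  | .node l r =>
    letI := instDecidableEqInternal l
    letI := instDecidableEqInternal r
    inferInstanceAs (DecidableEq (Option (Internal l ⊕ Internal r)))

section Restriction

variable {l r : BTree} {β : Type*}

/-- Restriction of a leaf labeling to the left subtree. -/
def leafL (a : Leaf (.node l r) → β) : Leaf l → β := fun x => a (Sum.inl x)

/-- Restriction of a leaf labeling to the right subtree. -/
def leafR (a : Leaf (.node l r) → β) : Leaf r → β := fun x => a (Sum.inr x)

/-- The label of the root. -/
def atRoot (k : Internal (.node l r) → β) : β := k none

/-- Restriction of a labeling of the internal vertices to the left subtree. -/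
def intL (k : Internal (.node l r) → β) : Internal l → β := fun v => k (some (Sum.inl v))

/-- Restriction of a labeling of the internal vertices to the right subtree. -/
def intR (k : Internal (.node l r) → β) : Internal r → β := fun v => k (some (Sum.inr v))

end Restriction

/-- The sum of the parts of a composition (a labeling of the leaves). -/
def total {T : BTree} (a : Leaf T → ℕ) : ℕ := ∑ x, a x

/-- The representation label of the root of a tree; the label of a leaf is `0`. -/
def repRoot : (T : BTree) → (Internal T → ℕ) → ℕ
  | .leaf, _ => 0
  | .node _ _, k => atRoot k

/-- Representation labelings of the tree with composition `a`: at each internal vertex with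
representation label `k`, whose sons have representation labels `i, j` and composition labels with
sums `p, q`, one has `i ≤ p/2`, `j ≤ q/2`, `k - p ≤ j - i ≤ q - k` and `i + j ≤ k`. -/
def IsRepLabeling : (T : BTree) → (Leaf T → ℕ) → (Internal T → ℕ) → Prop
  | .leaf, _, _ => True
  | .node l r, a, k =>
    2 * repRoot l (intL k) ≤ total (leafL a) ∧
    2 * repRoot r (intR k) ≤ total (leafR a) ∧
    ((atRoot k : ℕ) : ℤ) - total (leafL a) ≤ (repRoot r (intR k) : ℤ) - repRoot l (intL k) ∧
    (repRoot r (intR k) : ℤ) - repRoot l (intL k) ≤ (total (leafR a) : ℤ) - (atRoot k : ℕ) ∧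
    repRoot l (intL k) + repRoot r (intR k) ≤ atRoot k ∧
    IsRepLabeling l (leafL a) (intL k) ∧
    IsRepLabeling r (leafR a) (intR k)

/-- The naturals `w` with `max {j, i - p + m} ≤ w ≤ min {q - j, m - i}` (subtractions in `ℤ`). -/
def wRange (p q m i j : ℕ) : Finset ℕ :=
  (Finset.range (m + 1)).filter fun w : ℕ =>
    max (j : ℤ) ((i : ℤ) - p + m) ≤ w ∧ (w : ℤ) ≤ min ((q : ℤ) - j) ((m : ℤ) - i)

/-- The range of the variable at the root of a tree with composition `a`, space label `m` and
representation labels `k`. -/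
def rootRange {l r : BTree} (a : Leaf (.node l r) → ℕ) (k : Internal (.node l r) → ℕ) (m : ℕ) :
    Finset ℕ :=
  wRange (total (leafL a)) (total (leafR a)) m (repRoot l (intL k)) (repRoot r (intR k))

/-- The coefficient `E_{k-i-j}(q - 2j, p - 2i, m - i - j, w - j)` at the root, where `i, j` are the
representation labels of the sons and `p, q` the sums of their composition labels. -/
def rootCoeff {l r : BTree} (a : Leaf (.node l r) → ℕ) (k : Internal (.node l r) → ℕ) (m w : ℕ) :
    ℂ :=
  (hahnE (atRoot k - repRoot l (intL k) - repRoot r (intR k))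
    ((total (leafR a) : ℤ) - 2 * repRoot r (intR k))
    ((total (leafL a) : ℤ) - 2 * repRoot l (intL k))
    ((m : ℤ) - repRoot l (intL k) - repRoot r (intR k))
    ((w : ℤ) - repRoot r (intR k)) : ℤ)

/-- Admissible variable labelings for the space label `m`: the variable `w` at the root is in its
range, and the labelings of the left and right subtree are admissible for the space labels
`m - w` and `w`. -/
def IsVarLabeling : (T : BTree) → (Leaf T → ℕ) → (Internal T → ℕ) → ℕ → (Internal T → ℕ) → Prop
  | .leaf, _, _, _, _ => True
  | .node l r, a, k, m, w =>
    atRoot w ∈ rootRange a k m ∧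
    IsVarLabeling l (leafL a) (intL k) (m - atRoot w) (intL w) ∧
    IsVarLabeling r (leafR a) (intR k) (atRoot w) (intR w)

open Classical in
/-- The finite set of admissible variable labelings (their values are at most `m`). -/
def varLabelings (T : BTree) (a : Leaf T → ℕ) (k : Internal T → ℕ) (m : ℕ) :
    Finset (Internal T → ℕ) :=
  (Fintype.piFinset fun _ => Finset.range (m + 1)).filter (IsVarLabeling T a k m)

/-- The multidimensional Hahn polynomial of the tree. -/
def treeHahn : (T : BTree) → (Leaf T → ℕ) → (Internal T → ℕ) → ℕ → (Internal T → ℕ) → ℂ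
  | .leaf, _, _, _, _ => 1
  | .node l r, a, k, m, w =>
    rootCoeff a k m (atRoot w) *
      treeHahn l (leafL a) (intL k) (m - atRoot w) (intL w) *
      treeHahn r (leafR a) (intR k) (atRoot w) (intR w)

/-- The numbers `x_1, …, x_h` at the leaves: the space label `m` of a vertex with variable label `w`
is split into `m - w` on the left and `w` on the right. -/
def leafValues : (T : BTree) → ℕ → (Internal T → ℕ) → Leaf T → ℕ
  | .leaf, m, _ => fun _ => m
  | .node l r, m, w =>
    Sum.elim (leafValues l (m - atRoot w) (intL w)) (leafValues r (atRoot w) (intR w))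

/-! ### Permutation modules

Everything lives in a finite set `α`. The space of functions on a set `Ω` of subsets of `α` (or of
tuples of subsets) is identified with the space of functions on all subsets (or tuples) that vanish
outside `Ω`. -/

section Modules

variable {α : Type} [Fintype α] [DecidableEq α]

/-- The permutation representation on functions: `(g f)(x) = f(g⁻¹ x)`. -/
def permRep (X : Type) [MulAction (Equiv.Perm α) X] :
    Representation ℂ (Equiv.Perm α) (X → ℂ) where
  toFun g := LinearMap.funLeft ℂ ℂ (fun x : X => g⁻¹ • x)
  map_one' := by
    ext f x
    simp [LinearMap.funLeft]
  map_mul' g h := by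
    ext f x
    simp [LinearMap.funLeft, mul_smul]

/-- The symmetric group of the subset `Z`: the permutations that fix all points outside `Z`. -/
def symOn (Z : Finset α) : Set (Equiv.Perm α) := {g | ∀ x, x ∉ Z → g x = x}

/-- `M^{n-m,m}(Z)`, `n = |Z|`: the functions on the `m`-subsets of `Z`. -/
def johnsonM (Z : Finset α) (m : ℕ) : Submodule ℂ (Finset α → ℂ) where
  carrier := {f | ∀ C, C ∉ Z.powersetCard m → f C = 0}
  zero_mem' := fun _ _ => rfl
  add_mem' := fun hf hg C hC => by simp [hf C hC, hg C hC]
  smul_mem' := fun c f hf C hC => by simp [hf C hC]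

/-- The Radon transform `d δ_A = ∑_{x ∈ A} δ_{A ∖ {x}}`, that is
`(d f)(C) = ∑_{x ∉ C} f(C ∪ {x})`. -/
def radonD : (Finset α → ℂ) →ₗ[ℂ] (Finset α → ℂ) where
  toFun f C := ∑ x ∈ Cᶜ, f (insert x C)
  map_add' f g := by
    ext C
    simp [Finset.sum_add_distrib]
  map_smul' c f := by
    ext C
    simp [Finset.mul_sum]

/-- `S^{n-k,k}(Z) = M^{n-k,k}(Z) ∩ Ker d`, `n = |Z|`. -/
def johnsonS (Z : Finset α) (k : ℕ) : Submodule ℂ (Finset α → ℂ) :=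
  johnsonM Z k ⊓ LinearMap.ker radonD

/-- `S^{n-k,k}(Z)` is invariant under the symmetric group of `Z`. -/
theorem permRep_mem_johnsonS (Z : Finset α) (k : ℕ) {g : Equiv.Perm α} (hg : g ∈ symOn Z)
    {f : Finset α → ℂ} (hf : f ∈ johnsonS Z k) :
    permRep (Finset α) g f ∈ johnsonS Z k := by
  have hZ : g • Z = Z := by
    have h1 : ∀ x, x ∈ Z → g x ∈ Z := by
      intro x hx
      by_contra h
      have h2 := hg _ h
      have h3 := g.injective h2
      rw [h3] at h
      exact h hx
    apply Finset.eq_of_subset_of_card_le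
    · intro y hy
      obtain ⟨x, hx, rfl⟩ := Finset.mem_smul_finset.1 hy
      exact h1 x hx
    · simp
  refine ⟨?_, ?_⟩
  · intro C hC
    refine hf.1 _ fun h => hC ?_
    rw [Finset.mem_powersetCard] at h ⊢
    refine ⟨?_, by simpa using h.2⟩
    have h4 := Finset.smul_finset_subset_smul_finset (a := g) h.1
    rwa [smul_inv_smul, hZ] at h4
  · have h5 : radonD f = 0 := hf.2
    change radonD (permRep (Finset α) g f) = 0
    ext C
    have h6 := congrFun h5 (g⁻¹ • C)
    rw [Pi.zero_apply] at h6 ⊢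
    rw [← h6]
    refine Finset.sum_equiv g⁻¹ ?_ ?_
    · intro x
      simp [Finset.mem_compl, Finset.mem_inv_smul_finset_iff]
    · intro x _
      change f (g⁻¹ • insert x C) = _
      congr 1
      simp [Finset.smul_finset_insert]

/-- The hermitian product on functions on subsets, linear in the first argument. -/
def herm (f g : Finset α → ℂ) : ℂ := ∑ C, f C * (starRingEnd ℂ) (g C)

/-- `U` is an `S_Z`-subrepresentation isomorphic to `S^{n-k,k}(Z)`: it is the image of
`S^{n-k,k}(Z)` under a linear isomorphism that commutes with the symmetric group of `Z`. -/
def IsCopy {X : Type} [MulAction (Equiv.Perm α) X] (Z : Finset α) (k : ℕ)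
    (U : Submodule ℂ (X → ℂ)) : Prop :=
  ∃ e : johnsonS Z k ≃ₗ[ℂ] U, ∀ (g : Equiv.Perm α) (hg : g ∈ symOn Z) (f : johnsonS Z k),
    (e ⟨permRep (Finset α) g f, permRep_mem_johnsonS Z k hg f.2⟩ : X → ℂ) = permRep X g (e f)

/-- `Ω_a(Z)`: the ordered partitions of `Z`, indexed by the leaves, with blocks of sizes `a`. -/
def OmegaA {T : BTree} (a : Leaf T → ℕ) (Z : Finset α) : Set (Leaf T → Finset α) :=
  {B | (∀ x, (B x).card = a x) ∧ (∀ x y, x ≠ y → Disjoint (B x) (B y)) ∧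
    Finset.univ.biUnion B = Z}

/-- The permutation module `M^a(Z)` of all functions on `Ω_a(Z)`. -/
def moduleM {T : BTree} (a : Leaf T → ℕ) (Z : Finset α) :
    Submodule ℂ ((Leaf T → Finset α) → ℂ) where
  carrier := {f | ∀ B, B ∉ OmegaA a Z → f B = 0}
  zero_mem' := fun _ _ => rfl
  add_mem' := fun hf hg B hB => by simp [hf B hB, hg B hB]
  smul_mem' := fun c f hf B hB => by simp [hf B hB]

/-- The tensor product of functions: if `f ∈ M^{a'}(F)` and `g ∈ M^{a''}(Z ∖ F)`, this is
`f ⊗ g ∈ M^{a'}(F) ⊗ M^{a''}(Z ∖ F) ⊆ M^a(Z)`. -/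
def tens {l r : BTree} (f : (Leaf l → Finset α) → ℂ) (g : (Leaf r → Finset α) → ℂ) :
    (Leaf (.node l r) → Finset α) → ℂ :=
  fun B => f (leafL B) * g (leafR B)

/-- The induced representation `⊕_F V'(F) ⊗ V''(Z ∖ F)`, sum over all `p`-subsets `F` of `Z`. -/
def induced {l r : BTree} (p : ℕ) (V' : Finset α → Submodule ℂ ((Leaf l → Finset α) → ℂ))
    (V'' : Finset α → Submodule ℂ ((Leaf r → Finset α) → ℂ)) (Z : Finset α) :
    Submodule ℂ ((Leaf (.node l r) → Finset α) → ℂ) :=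
  ⨆ F ∈ Z.powersetCard p,
    Submodule.span ℂ {h | ∃ f ∈ V' F, ∃ g ∈ V'' (Z \ F), h = tens f g}

/-- The subspace `[S^{n-k,k}]` of `M^a(Z)` associated with a representation labeling. For a leaf it
is the trivial representation. For a tree with subtrees `l` and `r` it is the subspace isomorphic to
`S^{n-k,k}(Z)` in the representation induced from the tensor product of the subspaces of `l` and `r`
(written as the sum of all such subspaces, so that it is defined before one knows that there is
exactly one). -/
def bracketS : (T : BTree) → (Leaf T → ℕ) → (Internal T → ℕ) → (Z : Finset α) →
    Submodule ℂ ((Leaf T → Finset α) → ℂ)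
  | .leaf, a, _, Z => moduleM a Z
  | .node l r, a, k, Z =>
    sSup {U | U ≤ induced (total (leafL a)) (bracketS l (leafL a) (intL k))
        (bracketS r (leafR a) (intR k)) Z ∧ IsCopy Z (atRoot k) U}

/-! ### The intertwining functions -/

/-- The tensor product of a function on subsets of `A` and a function on subsets of `B`, for
disjoint `A` and `B`; it satisfies `δ_X ⊗ δ_Y = δ_{X ∪ Y}`. -/
def setTens (A B : Finset α) (f g : Finset α → ℂ) : Finset α → ℂ :=
  fun C => if C ⊆ A ∪ B then f (C ∩ A) * g (C ∩ B) else 0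

/-- The functions `Φ(T(a), m, T_r(k))`, for the ordered partition `A = (A_1, …, A_h)`. -/
def Phi : (T : BTree) → (Leaf T → ℕ) → (Internal T → ℕ) → ℕ → (Leaf T → Finset α) →
    (Finset α → ℂ)
  | .leaf, _, _, m, A => fun C => if C ∈ (A ()).powersetCard m then 1 else 0
  | .node l r, a, k, m, A =>
    ∑ w ∈ rootRange a k m, rootCoeff a k m w •
      setTens (Finset.univ.biUnion (leafL A)) (Finset.univ.biUnion (leafR A))
        (Phi l (leafL a) (intL k) (m - w) (leafL A))
        (Phi r (leafR a) (intR k) w (leafR A))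

open Classical in
/-- `σ_x(Y) ⊗ σ_{a-x}(Z ∖ Y)`: the characteristic function of the set of all
`(B_1, …, B_h) ∈ Ω_a(Z)` with `|B_j ∩ Y| = x_j` for all `j`. -/
def sigmaA {T : BTree} (a x : Leaf T → ℕ) (Z Y : Finset α) : (Leaf T → Finset α) → ℂ :=
  fun B => if B ∈ OmegaA a Z ∧ ∀ j, (B j ∩ Y).card = x j then 1 else 0

/-- The function `Ψ(T(a), m, T_r(k)) ∈ M^a(Z)`, for the `m`-subset `Y` of `Z`. -/
def Psi (T : BTree) (a : Leaf T → ℕ) (k : Internal T → ℕ) (m : ℕ) (Z Y : Finset α) :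
    (Leaf T → Finset α) → ℂ :=
  ∑ w ∈ varLabelings T a k m, treeHahn T a k m w • sigmaA a (leafValues T m w) Z Y

/-- The function `Ξ(T(a), w, T_r(k)) ∈ M^a(Z)`: the sum of `[Ψ(T'(a), m-w) ⊗ Ψ(T''(a), w)]_F` over
the subsets `F` of `Z` with `|F| = a_1 + ⋯ + a_t` and `|F ∩ Y| = m - w`; the two factors are taken
in `M^{a'}(F)` and `M^{a''}(Z ∖ F)`, for the subsets `F ∩ Y` and `(Z ∖ F) ∩ Y`. -/
def Xi (l r : BTree) (a : Leaf (.node l r) → ℕ) (k : Internal (.node l r) → ℕ) (m w : ℕ)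
    (Z Y : Finset α) : (Leaf (.node l r) → Finset α) → ℂ :=
  ∑ F ∈ (Z.powersetCard (total (leafL a))).filter (fun F => (F ∩ Y).card = m - w),
    tens (Psi l (leafL a) (intL k) (m - w) F (F ∩ Y))
      (Psi r (leafR a) (intR k) w (Z \ F) ((Z \ F) ∩ Y))

end Modules

/-- The consecutive intervals of lengths `a_1, …, a_h` that start at `s`, as subsets of
`{0, …, n-1}`. -/
def intervals (n : ℕ) : (T : BTree) → (Leaf T → ℕ) → ℕ → Leaf T → Finset (Fin n)
  | .leaf, a, s => fun _ => Finset.univ.filter fun x : Fin n => s ≤ x.val ∧ x.val < s + a ()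
  | .node l r, a, s =>
    Sum.elim (intervals n l (leafL a) s) (intervals n r (leafR a) (s + total (leafL a)))

/-- The first `m` elements of `{0, …, n-1}`. -/
def firstY (n m : ℕ) : Finset (Fin n) := Finset.univ.filter fun x : Fin n => x.val < m

end HahnTree

end

open HahnTree

open scoped Pointwise

noncomputable section

namespace HahnTree

/-! ### Contiguity relations of the Hahn polynomials -/

/-! For fixed labels and a fixed ordered partition `B`, the functions `Φ` of all degrees `m` are
glued into one function `treeV` on subsets. It is a string (`IsString`): summing over deletions of a
point multiplies it by `|X| - k`, summing over insertions by `n - k - |X|`. This passes from the two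
subtrees to the tree because these two identities become contiguity relations of the Hahn
polynomials, `hahnE_raise` and `hahnE_lower`; hence `IsString.node` and `treeV_isString`. A string
vanishes below degree `k` and above degree `n - k`, so its degree `k` part lies in the kernel of
`d`: this is the invariant vector `v`. The inequalities for the labels make it nonzero.

Schur's lemma is replaced by explicit arguments with the reproducing kernels `kernelS` of
`S^{n-k,k}`. Vectors invariant under the permutations of `X` and of `Z \ X` form a space of
dimension at most one (`exists_smul_eq_of_swapInv`), and averaging over the stabilizer of a subset
then gives irreducibility (`johnsonS_le_of_invariant`). So the operator `treeT` of pairings with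
translates of `v` is injective on `S^{n-k,k}`, and its image `treeR` is a copy of that space. The
kernel at a `k`-subset `Y` goes to the function `Ψ` of `Y`; the raising relation then puts `Ψ` of
every larger subset into `treeR`, and these functions are its only bi-invariant vectors up to
scalars (`treePsi_mem_treeR`, `exists_eq_smul_treePsi`).

Multiplicity one is the core. Take an equivariant map from `S^{n-k,k}` to the representation induced
from the images of the two subtrees. On the partitions refining `(F, Z \ F)` the image of the kernel
at `Y` is a scalar times the product of the two smaller functions `Ψ` (`exists_eq_mul_treeV`).
Whether it vanishes there depends, for fixed `F`, only on `|Y ∩ F|` and `|Y ∩ (Z \ F)|`, and the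
relation `∑ x, kernelS (Y ∪ {x}) = 0` propagates vanishing from `w - 1` to `w = |Y ∩ (Z \ F)|`,
starting at `w = j`. So a map that vanishes at one suitable point is zero
(`IsKernelFamily.eq_zero`), any two maps are proportional, and every copy equals `treeR`
(`eq_treeR_of_isCopy`). Induction on the tree identifies `bracketS` with `treeR`
(`bracketS_eq_treeR`). The formulas for `Ψ` and `Ξ` come from unfolding the recursion of `Φ` along
the tree (`Psi_apply`, `Psi_eq_sum_Xi`). -/

theorem choose_succ_mul_int (s t : ℕ) :
    (s.choose (t + 1) : ℤ) * (t + 1) = s.choose t * ((s : ℤ) - t) := by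
  have h := Nat.choose_succ_right_eq s t
  rcases le_or_gt t s with hts | hts
  · have h' : ((s.choose (t + 1) * (t + 1) : ℕ) : ℤ) = ((s.choose t * (s - t) : ℕ) : ℤ) := by
      rw [h]
    push_cast [Nat.cast_sub hts] at h'
    exact h'
  · rw [Nat.choose_eq_zero_of_lt hts, Nat.choose_eq_zero_of_lt (by omega)]
    simp

theorem rising_succ (x : ℤ) (r : ℕ) : rising x (r + 1) = rising x r * (x + r) := by
  simp [rising, Finset.prod_range_succ]

theorem rising_neg_natCast (s t : ℕ) :
    rising (-(s : ℤ)) t = (-1) ^ t * (t.factorial : ℤ) * s.choose t := by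
  induction t with
  | zero => simp [rising]
  | succ t ih =>
    rw [rising_succ, ih, Nat.factorial_succ]
    have h := choose_succ_mul_int s t
    push_cast
    rw [pow_succ]
    linear_combination (-1) ^ t * (t.factorial : ℤ) * h

theorem rising_pos {x : ℤ} (hx : 0 < x) (r : ℕ) : 0 < rising x r :=
  Finset.prod_pos fun s _ => by positivity

/-- The coefficient of `binom s t * binom u (κ - t)` in the expansion of a Hahn polynomial. -/
def hahnCoeff (κ : ℕ) (a b : ℤ) (t : ℕ) : ℤ :=
  (-1) ^ t * rising (b - κ + 1) t * rising (a - κ + 1) (κ - t)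

/-- Rising factorials at `-s` and `-u` are signed binomial coefficients times factorials. In these
coordinates the limits of summation in `hahnE` become superfluous, since the omitted terms contain a
vanishing binomial coefficient. -/
theorem hahnE_eq_sum_choose (κ : ℕ) (a b : ℤ) (u s : ℕ) :
    hahnE κ a b ((u : ℤ) + s) s =
      (-1) ^ κ * (κ.factorial : ℤ) *
        ∑ t ∈ Finset.range (κ + 1), hahnCoeff κ a b t * (s.choose t * u.choose (κ - t)) := by
  rw [hahnE, Finset.sum_filter, Finset.mul_sum]
  refine Finset.sum_congr rfl fun t ht => ?_
  have htκ : t ≤ κ := Nat.lt_succ_iff.1 (Finset.mem_range.1 ht)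
  have hf : ((κ.choose t : ℤ) * t.factorial * (κ - t).factorial) = κ.factorial := by
    exact_mod_cast Nat.choose_mul_factorial_mul_factorial htκ
  have hp : (-1 : ℤ) ^ κ = (-1) ^ t * (-1) ^ (κ - t) := by
    rw [← pow_add]; congr 1; omega
  have hs : (s : ℤ) - (u + s) = -(u : ℤ) := by ring
  have hmain : (-1) ^ t * (κ.choose t : ℤ) * rising (b - κ + 1) t * rising (-s) t *
      rising (a - κ + 1) (κ - t) * rising ((s : ℤ) - (u + s)) (κ - t) =
      (-1) ^ κ * (κ.factorial : ℤ) * (hahnCoeff κ a b t * (s.choose t * u.choose (κ - t))) := by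
    rw [hs, rising_neg_natCast, rising_neg_natCast, ← hf, hp, hahnCoeff]
    ring
  split_ifs with h
  · exact hmain
  · rw [not_and_or] at h
    have h0 : s.choose t * u.choose (κ - t) = 0 := by
      rcases h with h | h
      · rw [Nat.choose_eq_zero_of_lt (n := u) (by omega), mul_zero]
      · rw [Nat.choose_eq_zero_of_lt (n := s) (by omega), zero_mul]
    have h0' : ((s.choose t : ℤ) * u.choose (κ - t)) = 0 := by exact_mod_cast h0
    rw [h0']
    simp

/-- True term by term, whatever the coefficients: `v * choose (v-1) r = (v - r) * choose v r`
produces the factors `u - (κ - t)` and `s - t`, whose sum does not depend on `t`. -/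
theorem hahnE_raise (κ : ℕ) (a b : ℤ) (u s : ℕ) :
    (u : ℤ) * hahnE κ a b (((u - 1 : ℕ) : ℤ) + s) s +
        (s : ℤ) * hahnE κ a b ((u : ℤ) + (s - 1 : ℕ)) (s - 1 : ℕ) =
      ((u : ℤ) + s - κ) * hahnE κ a b ((u : ℤ) + s) s := by
  have key : ∀ v r : ℕ, (v : ℤ) * (v - 1).choose r = (v - r) * v.choose r := by
    intro v r
    cases v with
    | zero => cases r <;> simp
    | succ v =>
      have h1 : ((v.choose r * (v + 1) : ℕ) : ℤ) = (((v + 1).choose (r + 1) * (r + 1) : ℕ) : ℤ) := by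
        rw [mul_comm, Nat.add_one_mul_choose_eq]
      have h2 := choose_succ_mul_int (v + 1) r
      push_cast at h1 h2 ⊢
      linear_combination h1 + h2
  rw [hahnE_eq_sum_choose, hahnE_eq_sum_choose, hahnE_eq_sum_choose]
  have : (∑ t ∈ Finset.range (κ + 1), hahnCoeff κ a b t *
        ((u : ℤ) * (s.choose t * (u - 1).choose (κ - t)) +
          s * ((s - 1).choose t * u.choose (κ - t)))) =
      ((u : ℤ) + s - κ) *
        ∑ t ∈ Finset.range (κ + 1), hahnCoeff κ a b t * (s.choose t * u.choose (κ - t)) := by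
    rw [Finset.mul_sum]
    refine Finset.sum_congr rfl fun t ht => ?_
    have htκ : t ≤ κ := Nat.lt_succ_iff.1 (Finset.mem_range.1 ht)
    have h1 := key u (κ - t)
    have h2 := key s t
    rw [Nat.cast_sub htκ] at h1
    linear_combination hahnCoeff κ a b t * s.choose t * h1 +
      hahnCoeff κ a b t * u.choose (κ - t) * h2
  have h3 : ∀ x y z c : ℤ, (u : ℤ) * x + s * y = z → u * (c * x) + s * (c * y) = c * z := by
    intro x y z c h; rw [← h]; ring
  rw [h3 _ _ _ _ (Eq.trans ?_ this)]
  · ring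
  · rw [Finset.mul_sum, Finset.mul_sum, ← Finset.sum_add_distrib]
    refine Finset.sum_congr rfl fun t _ => ?_
    ring

/-- The two-term recurrence that singles out the Hahn coefficients; it is what makes the sum in
`hahnE_lower` telescope. -/
theorem hahnCoeff_succ (κ : ℕ) (a b : ℤ) (t : ℕ) (ht : t < κ) :
    hahnCoeff κ a b t * (b - κ + 1 + t) + hahnCoeff κ a b (t + 1) * (a - t) = 0 := by
  obtain ⟨r, rfl⟩ : ∃ r, κ = t + 1 + r := ⟨κ - (t + 1), by omega⟩
  have h1 : t + 1 + r - t = r + 1 := by omega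
  have h2 : t + 1 + r - (t + 1) = r := by omega
  rw [hahnCoeff, hahnCoeff, h1, h2, rising_succ, rising_succ]
  push_cast
  ring

/-- Pascal's rule splits each term into the wanted one, with factor `(b - u - (κ - t)) + (a - s -
t)`, and boundary contributions; by `hahnCoeff_succ` the latter are differences of consecutive
values of one sequence. -/
theorem hahnE_lower (κ : ℕ) (a b : ℤ) (u s : ℕ) :
    (b - u) * hahnE κ a b (((u + 1 : ℕ) : ℤ) + s) s +
        (a - s) * hahnE κ a b ((u : ℤ) + (s + 1 : ℕ)) (s + 1 : ℕ) =
      (a + b - κ - u - s) * hahnE κ a b ((u : ℤ) + s) s := by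
  -- The telescoping sequence. The value `0` at `κ + 1` must be imposed: it stands for a binomial
  -- coefficient with lower index `-1`, whereas the truncated `κ - (κ + 1)` would give `1`.
  let H : ℕ → ℤ := fun t => match t with
    | 0 => 0
    | t + 1 => if t = κ then 0 else
      -(hahnCoeff κ a b t * (b - κ + 1 + t) * (s.choose t * u.choose (κ - (t + 1))))
  have this : (∑ t ∈ Finset.range (κ + 1), hahnCoeff κ a b t *
        ((b - u) * (s.choose t * (u + 1).choose (κ - t)) +
          (a - s) * ((s + 1).choose t * u.choose (κ - t)))) =
      (a + b - κ - u - s) *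
        ∑ t ∈ Finset.range (κ + 1), hahnCoeff κ a b t * (s.choose t * u.choose (κ - t)) := by
    rw [Finset.mul_sum, ← sub_eq_zero, ← Finset.sum_sub_distrib]
    have h0 : ∑ t ∈ Finset.range (κ + 1), (H t - H (t + 1)) = 0 := by
      rw [Finset.sum_range_sub']
      simp [H]
    rw [← h0]
    refine Finset.sum_congr rfl fun t ht => ?_
    have htκ : t ≤ κ := Nat.lt_succ_iff.1 (Finset.mem_range.1 ht)
    -- the contribution of the first variable
    have hU : (b - u) * ((u + 1).choose (κ - t) : ℤ) * hahnCoeff κ a b t * s.choose t =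
        (b - u - (κ - t)) * u.choose (κ - t) * hahnCoeff κ a b t * s.choose t - H (t + 1) := by
      rcases htκ.eq_or_lt with rfl | hlt
      · simp [H]
      · have hr : κ - t = (κ - (t + 1)) + 1 := by omega
        have hne : t ≠ κ := hlt.ne
        simp only [H, hne, if_false]
        have h1 := choose_succ_mul_int u (κ - (t + 1))
        rw [hr, Nat.choose_succ_succ', Nat.cast_add]
        rw [Nat.cast_sub (by omega)] at h1
        push_cast at h1 ⊢
        linear_combination hahnCoeff κ a b t * s.choose t * h1
    have hS : (a - s) * ((s + 1).choose t : ℤ) * hahnCoeff κ a b t * u.choose (κ - t) =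
        (a - s - t) * s.choose t * hahnCoeff κ a b t * u.choose (κ - t) + H t := by
      cases t with
      | zero => simp [H]
      | succ t =>
        have hne : t ≠ κ := by omega
        simp only [H, hne, if_false]
        have h1 := choose_succ_mul_int s t
        have h2 := hahnCoeff_succ κ a b t (by omega)
        rw [Nat.choose_succ_succ', Nat.cast_add]
        push_cast
        linear_combination hahnCoeff κ a b (t + 1) * u.choose (κ - (t + 1)) * h1 +
          s.choose t * u.choose (κ - (t + 1)) * h2
    linear_combination hU + hS
  rw [hahnE_eq_sum_choose, hahnE_eq_sum_choose, hahnE_eq_sum_choose]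
  have h3 : ∀ x y z c : ℤ, (b - u : ℤ) * x + (a - s) * y = z →
      (b - u : ℤ) * (c * x) + (a - s) * (c * y) = c * z := by
    intro x y z c h; rw [← h]; ring
  rw [h3 _ _ _ _ (Eq.trans ?_ this)]
  · ring
  · rw [Finset.mul_sum, Finset.mul_sum, ← Finset.sum_add_distrib]
    refine Finset.sum_congr rfl fun t _ => ?_
    ring

/-- At `x = 0` only the term `t = 0` survives, and its rising factorial starts at `a - κ + 1 > 0`.
-/
theorem hahnE_ne_zero (κ : ℕ) (a b : ℤ) (ha : (κ : ℤ) ≤ a) : hahnE κ a b κ 0 ≠ 0 := by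
  have h := hahnE_eq_sum_choose κ a b κ 0
  simp only [Nat.cast_zero, add_zero] at h
  rw [h]
  refine mul_ne_zero (by positivity) ?_
  rw [Finset.sum_eq_single 0]
  · have := rising_pos (x := a - κ + 1) (by omega) κ
    simp [hahnCoeff, rising] at this ⊢
    exact this.ne'
  · intro t _ ht
    rw [Nat.choose_eq_zero_of_lt (Nat.pos_of_ne_zero ht)]
    simp
  · simp

/-! ### Strings: functions on which the raising and lowering operators act by scalars -/

section Strings

variable {α : Type} [DecidableEq α]

/-- `V` is the sum of the divided powers of the raising operator applied to a vector of
`S^{n-i,i}(Z)`, `n = |Z|`: its degree `m` part is the vector of degree `m`. -/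
structure IsString (Z : Finset α) (i : ℕ) (V : Finset α → ℂ) : Prop where
  supp : ∀ X, ¬X ⊆ Z → V X = 0
  raise : ∀ X, X ⊆ Z → ∑ x ∈ X, V (X.erase x) = ((X.card : ℂ) - i) * V X
  lower : ∀ X, X ⊆ Z → ∑ x ∈ Z \ X, V (insert x X) = ((Z.card : ℂ) - i - X.card) * V X

/-- Below degree `i` the raising scalar is nonzero, so the values in one degree are determined by
those in the degree below; at the empty set the sum is empty. -/
theorem IsString.eq_zero_of_card_lt {Z : Finset α} {i : ℕ} {V : Finset α → ℂ}
    (h : IsString Z i V) (X : Finset α) (hX : X.card < i) : V X = 0 := by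
  induction hc : X.card generalizing X with
  | zero =>
    by_cases hs : X ⊆ Z
    · have h1 := h.raise X hs
      rw [Finset.card_eq_zero.1 hc] at h1 ⊢
      simp only [Finset.sum_empty, Finset.card_empty, Nat.cast_zero, zero_sub] at h1
      have h2 : (-(i : ℂ)) ≠ 0 := by
        rw [neg_ne_zero]; exact_mod_cast (by omega : i ≠ 0)
      exact (mul_eq_zero.1 h1.symm).resolve_left h2
    · exact h.supp X hs
  | succ c ih =>
    by_cases hs : X ⊆ Z
    · have h1 := h.raise X hs
      rw [Finset.sum_eq_zero] at h1
      · have h2 : ((X.card : ℂ) - i) ≠ 0 := by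
          rw [sub_ne_zero]; exact_mod_cast (by omega : X.card ≠ i)
        exact (mul_eq_zero.1 h1.symm).resolve_left h2
      · intro x hx
        have h3 := Finset.card_erase_of_mem hx
        exact ih _ (by omega) (by omega)
    · exact h.supp X hs

/-- The mirror image: the lowering relation determines a value from those one degree higher,
starting from the empty sum at `X = Z`. -/
theorem IsString.eq_zero_of_lt_card {Z : Finset α} {i : ℕ} {V : Finset α → ℂ}
    (h : IsString Z i V) (X : Finset α) (hX : Z.card < X.card + i) : V X = 0 := by
  by_cases hs : X ⊆ Z
  swap
  · exact h.supp X hs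
  have hcard := Finset.card_le_card hs
  induction hc : Z.card - X.card generalizing X with
  | zero =>
    have hXZ : X = Z := Finset.eq_of_subset_of_card_le hs (by omega)
    have h1 := h.lower X hs
    rw [hXZ] at h1 ⊢
    simp only [Finset.sdiff_self, Finset.sum_empty] at h1
    have h2 : ((Z.card : ℂ) - i - Z.card) ≠ 0 := by
      have : (i : ℂ) ≠ 0 := by exact_mod_cast (by omega : i ≠ 0)
      intro h3; apply this; linear_combination -h3
    exact (mul_eq_zero.1 h1.symm).resolve_left h2
  | succ c ih =>
    have h1 := h.lower X hs
    rw [Finset.sum_eq_zero] at h1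
    · have h2 : ((Z.card : ℂ) - i - X.card) ≠ 0 := by
        have : (Z.card : ℂ) ≠ X.card + i := by exact_mod_cast (by omega : Z.card ≠ X.card + i)
        intro h3; apply this; linear_combination h3
      exact (mul_eq_zero.1 h1.symm).resolve_left h2
    · intro x hx
      obtain ⟨hxZ, hxX⟩ := Finset.mem_sdiff.1 hx
      have h3 := Finset.card_insert_of_notMem hxX
      have h4 : insert x X ⊆ Z := Finset.insert_subset hxZ hs
      have h5 := Finset.card_le_card h4
      exact ih _ (by omega) h4 h5 (by omega)

/-- If a string vanished in degree `m + 1 ≤ |Z| - i`, the lowering relation, whose scalar is nonzero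
in degree `m`, would make it vanish in degree `m` as well. -/
theorem IsString.exists_ne_zero {Z : Finset α} {i : ℕ} {V : Finset α → ℂ}
    (h : IsString Z i V) (h0 : ∃ X, X.card = i ∧ V X ≠ 0) (m : ℕ) (him : i ≤ m)
    (hm : m + i ≤ Z.card) : ∃ X, X.card = m ∧ V X ≠ 0 := by
  induction m, him using Nat.le_induction with
  | base => exact h0
  | succ m him ih =>
    obtain ⟨X, hX, hV⟩ := ih (by omega)
    by_contra! hcon
    have hs : X ⊆ Z := by
      by_contra hs; exact hV (h.supp X hs)
    have h1 := h.lower X hs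
    rw [Finset.sum_eq_zero] at h1
    · have h2 : ((Z.card : ℂ) - i - X.card) ≠ 0 := by
        have : (Z.card : ℂ) ≠ X.card + i := by exact_mod_cast (by omega : Z.card ≠ X.card + i)
        intro h3; apply this; linear_combination h3
      exact hV ((mul_eq_zero.1 h1.symm).resolve_left h2)
    · intro x hx
      exact hcon _ (by rw [Finset.card_insert_of_notMem (Finset.mem_sdiff.1 hx).2, hX])

theorem isString_indicator_subset (Z : Finset α) :
    IsString Z 0 (fun X => if X ⊆ Z then 1 else 0) where
  supp X hX := by simp [hX]
  raise X hX := by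
    have : ∀ x ∈ X, (if X.erase x ⊆ Z then (1 : ℂ) else 0) = 1 := fun x _ => by
      rw [if_pos ((Finset.erase_subset x X).trans hX)]
    rw [Finset.sum_congr rfl this]
    simp [hX]
  lower X hX := by
    have : ∀ x ∈ Z \ X, (if insert x X ⊆ Z then (1 : ℂ) else 0) = 1 := fun x hx => by
      rw [if_pos (Finset.insert_subset (Finset.mem_sdiff.1 hx).1 hX)]
    rw [Finset.sum_congr rfl this]
    simp [hX, Finset.card_sdiff_of_subset, Nat.cast_sub (Finset.card_le_card hX)]

/-- The combination of two strings for disjoint sets `F` and `G`, with Hahn polynomials as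
coefficients. -/
def stringNode (κ i j : ℕ) (F G : Finset α) (V V' : Finset α → ℂ) (X : Finset α) : ℂ :=
  if X ⊆ F ∪ G then
    ((hahnE κ ((G.card : ℤ) - 2 * j) ((F.card : ℤ) - 2 * i) ((X.card : ℤ) - i - j)
      (((X ∩ G).card : ℤ) - j) : ℤ) : ℂ) * V (X ∩ F) * V' (X ∩ G) else 0

theorem card_eq_inter_add_inter {F G X : Finset α} (hFG : Disjoint F G) (hX : X ⊆ F ∪ G) :
    X.card = (X ∩ F).card + (X ∩ G).card := by
  rw [← Finset.card_union_of_disjoint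
    (hFG.mono Finset.inter_subset_right Finset.inter_subset_right),
    ← Finset.inter_union_distrib_left, Finset.inter_eq_left.2 hX]

/-- Removing or adding a point of `F` affects only `V`, a point of `G` only `V'`. The relations for
`V` and `V'` turn both parts into scalars, and what remains is a contiguity relation in `u = |X ∩ F|
- i` and `s = |X ∩ G| - j`. -/
theorem IsString.node {F G : Finset α} {i j : ℕ} {V V' : Finset α → ℂ} (hV : IsString F i V)
    (hV' : IsString G j V') (hFG : Disjoint F G) (κ : ℕ) :
    IsString (F ∪ G) (i + j + κ) (stringNode κ i j F G V V') where
  supp X hX := by simp [stringNode, hX]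
  raise X hX := by
    have hcard := card_eq_inter_add_inter hFG hX
    set a : ℤ := (G.card : ℤ) - 2 * j
    set b : ℤ := (F.card : ℤ) - 2 * i
    have hX2 : X = (X ∩ F) ∪ (X ∩ G) := by
      rw [← Finset.inter_union_distrib_left, Finset.inter_eq_left.2 hX]
    have hdis : Disjoint (X ∩ F) (X ∩ G) :=
      hFG.mono Finset.inter_subset_right Finset.inter_subset_right
    have hsum : ∑ x ∈ X, stringNode κ i j F G V V' (X.erase x) =
        (hahnE κ a b ((X.card : ℤ) - 1 - i - j) (((X ∩ G).card : ℤ) - j) : ℤ) *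
          (∑ x ∈ X ∩ F, V ((X ∩ F).erase x)) * V' (X ∩ G) +
        (hahnE κ a b ((X.card : ℤ) - 1 - i - j) (((X ∩ G).card : ℤ) - 1 - j) : ℤ) *
          V (X ∩ F) * (∑ x ∈ X ∩ G, V' ((X ∩ G).erase x)) := by
      conv_lhs => rw [hX2, Finset.sum_union hdis, ← hX2]
      rw [Finset.mul_sum, Finset.mul_sum, Finset.sum_mul]
      congr 1
      · refine Finset.sum_congr rfl fun x hx => ?_
        obtain ⟨hxX, hxF⟩ := Finset.mem_inter.1 hx
        have hxG : x ∉ X ∩ G := fun h =>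
          Finset.disjoint_left.1 hFG hxF (Finset.mem_inter.1 h).2
        have hc := Finset.card_pos.2 ⟨x, hxX⟩
        rw [stringNode, if_pos ((Finset.erase_subset x X).trans hX), Finset.erase_inter,
          Finset.erase_inter, Finset.erase_eq_of_notMem hxG, Finset.card_erase_of_mem hxX,
          Nat.cast_sub hc, Nat.cast_one]
      · refine Finset.sum_congr rfl fun x hx => ?_
        obtain ⟨hxX, hxG⟩ := Finset.mem_inter.1 hx
        have hxF : x ∉ X ∩ F := fun h =>
          Finset.disjoint_left.1 hFG (Finset.mem_inter.1 h).2 hxG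
        have hc := Finset.card_pos.2 ⟨x, hxX⟩
        have hc' := Finset.card_pos.2 ⟨x, hx⟩
        rw [stringNode, if_pos ((Finset.erase_subset x X).trans hX), Finset.erase_inter,
          Finset.erase_inter, Finset.erase_eq_of_notMem hxF, Finset.card_erase_of_mem hxX,
          Finset.card_erase_of_mem hx,
          Nat.cast_sub hc, Nat.cast_sub hc', Nat.cast_one]
    rw [hsum, hV.raise _ Finset.inter_subset_right, hV'.raise _ Finset.inter_subset_right,
      stringNode, if_pos hX]
    -- If `u` or `s` would be negative, one of the two strings vanishes and so do both sides;
    -- otherwise they are natural numbers, as the contiguity relation requires.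
    rcases lt_or_ge (X ∩ F).card i with hF | hF
    · simp [hV.eq_zero_of_card_lt _ hF]
    rcases lt_or_ge (X ∩ G).card j with hG | hG
    · simp [hV'.eq_zero_of_card_lt _ hG]
    obtain ⟨u, hu⟩ := Nat.exists_eq_add_of_le hF
    obtain ⟨s, hs⟩ := Nat.exists_eq_add_of_le hG
    have key := hahnE_raise κ a b u s
    have e0 : (X.card : ℤ) - i - j = u + s := by rw [hcard, hu, hs]; push_cast; ring
    have e1 : ((X ∩ G).card : ℤ) - j = s := by rw [hs]; push_cast; ring
    -- The truncated `u - 1` and `s - 1` are wrong only at `0`, where the factor in front vanishes.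
    have e2 : (u : ℤ) * hahnE κ a b (((u - 1 : ℕ) : ℤ) + s) s =
        u * hahnE κ a b ((X.card : ℤ) - 1 - i - j) (((X ∩ G).card : ℤ) - j) := by
      rcases Nat.eq_zero_or_pos u with rfl | hu0
      · simp
      · rw [e1, show (X.card : ℤ) - 1 - i - j = ((u - 1 : ℕ) : ℤ) + s by
          rw [Nat.cast_sub hu0]; push_cast; linarith]
    have e3 : (s : ℤ) * hahnE κ a b ((u : ℤ) + (s - 1 : ℕ)) (s - 1 : ℕ) =
        s * hahnE κ a b ((X.card : ℤ) - 1 - i - j) (((X ∩ G).card : ℤ) - 1 - j) := by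
      rcases Nat.eq_zero_or_pos s with rfl | hs0
      · simp
      · rw [show ((X ∩ G).card : ℤ) - 1 - j = (s - 1 : ℕ) by
          rw [Nat.cast_sub hs0]; push_cast; linarith,
          show (X.card : ℤ) - 1 - i - j = (u : ℤ) + (s - 1 : ℕ) by
          rw [Nat.cast_sub hs0]; push_cast; linarith]
    rw [e2, e3, ← e0, ← e1] at key
    have key' := congrArg (Int.cast (R := ℂ)) key
    push_cast at key'
    rw [hu, hs] at hcard ⊢
    rw [hcard] at key' ⊢
    rw [hs] at key'
    push_cast at key' ⊢
    linear_combination V (X ∩ F) * V' (X ∩ G) * key'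
  lower X hX := by
    have hcard := card_eq_inter_add_inter hFG hX
    have hcardU : (F ∪ G).card = F.card + G.card := Finset.card_union_of_disjoint hFG
    set a : ℤ := (G.card : ℤ) - 2 * j with ha
    set b : ℤ := (F.card : ℤ) - 2 * i with hb
    have hX2 : (F ∪ G) \ X = (F \ (X ∩ F)) ∪ (G \ (X ∩ G)) := by
      ext x; simp only [Finset.mem_sdiff, Finset.mem_union, Finset.mem_inter]; tauto
    have hdis : Disjoint (F \ (X ∩ F)) (G \ (X ∩ G)) :=
      hFG.mono Finset.sdiff_subset Finset.sdiff_subset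
    have hsum : ∑ x ∈ (F ∪ G) \ X, stringNode κ i j F G V V' (insert x X) =
        (hahnE κ a b ((X.card : ℤ) + 1 - i - j) (((X ∩ G).card : ℤ) - j) : ℤ) *
          (∑ x ∈ F \ (X ∩ F), V (insert x (X ∩ F))) * V' (X ∩ G) +
        (hahnE κ a b ((X.card : ℤ) + 1 - i - j) (((X ∩ G).card : ℤ) + 1 - j) : ℤ) *
          V (X ∩ F) * (∑ x ∈ G \ (X ∩ G), V' (insert x (X ∩ G))) := by
      rw [hX2, Finset.sum_union hdis, Finset.mul_sum, Finset.mul_sum, Finset.sum_mul]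
      congr 1
      · refine Finset.sum_congr rfl fun x hx => ?_
        obtain ⟨hxF, hxX⟩ := Finset.mem_sdiff.1 hx
        have hxX' : x ∉ X := fun h => hxX (Finset.mem_inter.2 ⟨h, hxF⟩)
        have hxG : x ∉ G := Finset.disjoint_left.1 hFG hxF
        rw [stringNode, if_pos (Finset.insert_subset (Finset.mem_union_left _ hxF) hX),
          Finset.insert_inter_of_mem hxF, Finset.insert_inter_of_notMem hxG,
          Finset.card_insert_of_notMem hxX', Nat.cast_add, Nat.cast_one]
      · refine Finset.sum_congr rfl fun x hx => ?_
        obtain ⟨hxG, hxX⟩ := Finset.mem_sdiff.1 hx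
        have hxX' : x ∉ X := fun h => hxX (Finset.mem_inter.2 ⟨h, hxG⟩)
        have hxF : x ∉ F := Finset.disjoint_right.1 hFG hxG
        rw [stringNode, if_pos (Finset.insert_subset (Finset.mem_union_right _ hxG) hX),
          Finset.insert_inter_of_mem hxG, Finset.insert_inter_of_notMem hxF,
          Finset.card_insert_of_notMem hxX', Finset.card_insert_of_notMem hxX, Nat.cast_add,
          Nat.cast_add, Nat.cast_one]
    rw [hsum, hV.lower _ Finset.inter_subset_right, hV'.lower _ Finset.inter_subset_right,
      stringNode, if_pos hX]
    rcases lt_or_ge (X ∩ F).card i with hF | hF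
    · simp [hV.eq_zero_of_card_lt _ hF]
    rcases lt_or_ge (X ∩ G).card j with hG | hG
    · simp [hV'.eq_zero_of_card_lt _ hG]
    obtain ⟨u, hu⟩ := Nat.exists_eq_add_of_le hF
    obtain ⟨s, hs⟩ := Nat.exists_eq_add_of_le hG
    have key := hahnE_lower κ a b u s
    have e0 : (X.card : ℤ) - i - j = u + s := by rw [hcard, hu, hs]; push_cast; ring
    have e1 : ((X ∩ G).card : ℤ) - j = s := by rw [hs]; push_cast; ring
    have e2 : (((u + 1 : ℕ) : ℤ) + s) = (X.card : ℤ) + 1 - i - j := by push_cast; linarith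
    have e3 : ((u : ℤ) + (s + 1 : ℕ)) = (X.card : ℤ) + 1 - i - j := by push_cast; linarith
    have e4 : ((s + 1 : ℕ) : ℤ) = ((X ∩ G).card : ℤ) + 1 - j := by push_cast; linarith
    rw [e2, e3, e4, ← e0, ← e1] at key
    have key' := congrArg (Int.cast (R := ℂ)) key
    push_cast at key'
    rw [hu, hs] at hcard ⊢
    rw [hcard] at key' ⊢
    rw [hs] at key'
    rw [hcardU]
    simp only [ha, hb] at key' ⊢
    push_cast at key' ⊢
    linear_combination V (X ∩ F) * V' (X ∩ G) * key'

/-- The right part is taken in its lowest degree `j`, so the Hahn polynomial is evaluated at `x =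
0`, where it is known to be nonzero. The left part then has degree `i + κ`, which `hp` keeps within
the range of its string. -/
theorem stringNode_ne_zero {F G : Finset α} {i j κ : ℕ} {V V' : Finset α → ℂ}
    (hV : IsString F i V) (hV' : IsString G j V') (hFG : Disjoint F G)
    (h : ∃ X, X.card = i ∧ V X ≠ 0) (h' : ∃ X, X.card = j ∧ V' X ≠ 0)
    (hp : κ + 2 * i ≤ F.card) (hq : κ + 2 * j ≤ G.card) :
    ∃ X, (X.card = i + j + κ ∧ (X ∩ F).card = i + κ ∧ (X ∩ G).card = j) ∧
      V (X ∩ F) ≠ 0 ∧ V' (X ∩ G) ≠ 0 ∧ stringNode κ i j F G V V' X ≠ 0 := by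
  obtain ⟨X, hX, hVX⟩ := hV.exists_ne_zero h (i + κ) (by omega) (by omega)
  obtain ⟨Y, hY, hVY⟩ := h'
  have hXF : X ⊆ F := by by_contra hs; exact hVX (hV.supp X hs)
  have hYG : Y ⊆ G := by by_contra hs; exact hVY (hV'.supp Y hs)
  have h1 : (X ∪ Y) ∩ F = X := by
    rw [Finset.union_inter_distrib_right, Finset.inter_eq_left.2 hXF,
      Finset.disjoint_iff_inter_eq_empty.1 (hFG.symm.mono_left hYG), Finset.union_empty]
  have h2 : (X ∪ Y) ∩ G = Y := by
    rw [Finset.union_inter_distrib_right, Finset.inter_eq_left.2 hYG,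
      Finset.disjoint_iff_inter_eq_empty.1 (hFG.mono_left hXF), Finset.empty_union]
  have hs : X ∪ Y ⊆ F ∪ G := Finset.union_subset_union hXF hYG
  have hc := card_eq_inter_add_inter hFG hs
  rw [h1, h2] at hc
  refine ⟨X ∪ Y, ?_, ?_⟩
  · rw [h1, h2]; omega
  · rw [stringNode, if_pos hs, h1, h2]
    refine ⟨hVX, hVY, mul_ne_zero (mul_ne_zero ?_ hVX) hVY⟩
    have e1 : ((X ∪ Y).card : ℤ) - i - j = κ := by rw [hc, hX, hY]; push_cast; ring
    have e2 : (Y.card : ℤ) - j = 0 := by rw [hY]; ring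
    rw [e1, e2]
    exact Int.cast_ne_zero.2 (hahnE_ne_zero κ _ _ (by omega))

end Strings

/-! ### Ordered partitions indexed by the leaves of a tree -/

theorem total_node {l r : BTree} (a : Leaf (.node l r) → ℕ) :
    total a = total (leafL a) + total (leafR a) :=
  Fintype.sum_sum_type (α₁ := Leaf l) (α₂ := Leaf r) a

theorem total_leaf (a : Leaf .leaf → ℕ) : total a = a () :=
  Fintype.sum_unique (ι := Unit) a

section Partitions

variable {α : Type} [DecidableEq α]

/-- The union of the blocks. -/
def blocks {T : BTree} (B : Leaf T → Finset α) : Finset α := Finset.univ.biUnion B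

theorem mem_blocks {T : BTree} {B : Leaf T → Finset α} {x : α} : x ∈ blocks B ↔ ∃ s, x ∈ B s := by
  simp [blocks]

theorem blocks_node {l r : BTree} (B : Leaf (.node l r) → Finset α) :
    blocks B = blocks (leafL B) ∪ blocks (leafR B) := by
  ext x
  simp only [mem_blocks, Finset.mem_union]
  exact Sum.exists (α := Leaf l) (β := Leaf r)

theorem blocks_leaf (B : Leaf .leaf → Finset α) : blocks B = B () := by
  ext x
  rw [mem_blocks]
  exact ⟨fun ⟨_, h⟩ => h, fun h => ⟨(), h⟩⟩

theorem mem_OmegaA_leaf {a : Leaf .leaf → ℕ} {Z : Finset α} {B : Leaf .leaf → Finset α} :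
    B ∈ OmegaA a Z ↔ Z.card = a () ∧ B () = Z := by
  constructor
  · rintro ⟨h1, _, h3⟩
    have h4 : B () = Z := (blocks_leaf B).symm.trans h3
    exact ⟨h4 ▸ h1 (), h4⟩
  · rintro ⟨h1, h2⟩
    refine ⟨fun x => ?_, fun x y hxy => (hxy rfl).elim, (blocks_leaf B).trans h2⟩
    cases x
    rw [h2, h1]

theorem blocks_eq {T : BTree} {a : Leaf T → ℕ} {Z : Finset α} {B : Leaf T → Finset α}
    (hB : B ∈ OmegaA a Z) : blocks B = Z := hB.2.2

theorem card_of_mem_OmegaA {T : BTree} {a : Leaf T → ℕ} {Z : Finset α} {B : Leaf T → Finset α}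
    (hB : B ∈ OmegaA a Z) : Z.card = total a := by
  rw [← hB.2.2, Finset.card_biUnion fun x _ y _ hxy => hB.2.1 x y hxy]
  exact Finset.sum_congr rfl fun x _ => hB.1 x

theorem mem_OmegaA_node {l r : BTree} {a : Leaf (.node l r) → ℕ} {Z : Finset α}
    {B : Leaf (.node l r) → Finset α} :
    B ∈ OmegaA a Z ↔ blocks (leafL B) ⊆ Z ∧
      leafL B ∈ OmegaA (leafL a) (blocks (leafL B)) ∧
      leafR B ∈ OmegaA (leafR a) (Z \ blocks (leafL B)) := by
  constructor
  · rintro ⟨h1, h2, h3⟩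
    change blocks B = Z at h3
    rw [blocks_node] at h3
    have hdis : Disjoint (blocks (leafL B)) (blocks (leafR B)) := by
      rw [Finset.disjoint_left]
      intro x hx hx'
      obtain ⟨s, hs⟩ := mem_blocks.1 hx
      obtain ⟨t, ht⟩ := mem_blocks.1 hx'
      exact Finset.disjoint_left.1 (h2 (Sum.inl s) (Sum.inr t) (by exact Sum.inl_ne_inr)) hs ht
    refine ⟨h3 ▸ Finset.subset_union_left, ⟨fun x => h1 _, fun x y hxy => h2 _ _ ?_, rfl⟩,
      ⟨fun x => h1 _, fun x y hxy => h2 _ _ ?_, ?_⟩⟩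
    · exact fun h => hxy (Sum.inl_injective h)
    · exact fun h => hxy (Sum.inr_injective h)
    · rw [← h3, Finset.union_sdiff_cancel_left hdis]
      rfl
  · rintro ⟨h1, ⟨h2, h3, _⟩, ⟨h4, h5, h6⟩⟩
    change blocks (leafR B) = _ at h6
    have hdis : ∀ s t, Disjoint (leafL B s) (leafR B t) := by
      intro s t
      rw [Finset.disjoint_left]
      intro x hx hx'
      have h7 : x ∈ blocks (leafR B) := mem_blocks.2 ⟨t, hx'⟩
      rw [h6] at h7
      exact (Finset.mem_sdiff.1 h7).2 (mem_blocks.2 ⟨s, hx⟩)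
    refine ⟨?_, ?_, ?_⟩
    · rintro (s | s)
      · exact h2 s
      · exact h4 s
    · rintro (s | s) (t | t) hst
      · exact h3 s t fun h => hst (congrArg Sum.inl h)
      · exact hdis s t
      · exact (hdis t s).symm
      · exact h5 s t fun h => hst (congrArg Sum.inr h)
    · change blocks B = Z
      rw [blocks_node, h6, Finset.union_sdiff_of_subset h1]

theorem mem_OmegaA_node_iff {l r : BTree} {a : Leaf (.node l r) → ℕ} {Z F : Finset α}
    (hF : F ⊆ Z) {B : Leaf (.node l r) → Finset α} :
    B ∈ OmegaA a Z ∧ blocks (leafL B) = F ↔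
      leafL B ∈ OmegaA (leafL a) F ∧ leafR B ∈ OmegaA (leafR a) (Z \ F) := by
  rw [mem_OmegaA_node]
  constructor
  · rintro ⟨⟨_, h2, h3⟩, rfl⟩
    exact ⟨h2, h3⟩
  · rintro ⟨h2, h3⟩
    have h4 := blocks_eq h2
    subst h4
    exact ⟨⟨hF, h2, h3⟩, rfl⟩

theorem blocks_smul {T : BTree} (g : Equiv.Perm α) (B : Leaf T → Finset α) :
    blocks (g • B) = g • blocks B := by
  ext x
  rw [← Finset.inv_smul_mem_iff, mem_blocks, mem_blocks]
  simp only [Pi.smul_apply, ← Finset.inv_smul_mem_iff]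

theorem smul_mem_OmegaA {T : BTree} {a : Leaf T → ℕ} {Z : Finset α} (g : Equiv.Perm α)
    {B : Leaf T → Finset α} : g • B ∈ OmegaA a (g • Z) ↔ B ∈ OmegaA a Z := by
  change ((∀ x, (g • B x).card = a x) ∧ (∀ x y, x ≠ y → Disjoint (g • B x) (g • B y)) ∧
    blocks (g • B) = g • Z) ↔ _ ∧ _ ∧ blocks B = Z
  rw [blocks_smul, smul_left_cancel_iff]
  simp only [Finset.card_smul_finset, Finset.disjoint_iff_inter_eq_empty,
    ← Finset.smul_finset_inter, Finset.smul_finset_eq_empty]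

/-! ### The string attached to an ordered partition -/

/-- The function on all subsets whose part of degree `m` is `Φ(T(a), m, T_r(k))`. -/
def treeV : (T : BTree) → (Internal T → ℕ) → (Leaf T → Finset α) → Finset α → ℂ
  | .leaf, _, B => fun X => if X ⊆ B () then 1 else 0
  | .node l r, k, B =>
    stringNode (atRoot k - repRoot l (intL k) - repRoot r (intR k)) (repRoot l (intL k))
      (repRoot r (intR k)) (blocks (leafL B)) (blocks (leafR B))
      (treeV l (intL k) (leafL B)) (treeV r (intR k) (leafR B))

theorem treeV_isString (T : BTree) (a : Leaf T → ℕ) (k : Internal T → ℕ)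
    (hk : IsRepLabeling T a k) (Z : Finset α) (B : Leaf T → Finset α) (hB : B ∈ OmegaA a Z) :
    IsString Z (repRoot T k) (treeV T k B) := by
  induction T generalizing Z with
  | leaf =>
    obtain ⟨_, rfl⟩ := mem_OmegaA_leaf.1 hB
    exact isString_indicator_subset _
  | node l r ihl ihr =>
    obtain ⟨_, _, _, _, hij, hkl, hkr⟩ := hk
    obtain ⟨h1, h2, h3⟩ := mem_OmegaA_node.1 hB
    have hR := blocks_eq h3
    rw [← hR] at h3
    have h := (ihl _ _ hkl _ _ h2).node (ihr _ _ hkr _ _ h3)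
      (hR ▸ Finset.disjoint_sdiff) (atRoot k - repRoot l (intL k) - repRoot r (intR k))
    have e : repRoot l (intL k) + repRoot r (intR k) +
      (atRoot k - repRoot l (intL k) - repRoot r (intR k)) = atRoot k := by omega
    rw [e, ← blocks_node, blocks_eq hB] at h
    exact h

theorem treeV_smul (T : BTree) (k : Internal T → ℕ) (g : Equiv.Perm α) (B : Leaf T → Finset α)
    (X : Finset α) : treeV T k (g • B) (g • X) = treeV T k B X := by
  induction T generalizing X with
  | leaf =>
    change (if g • X ⊆ g • B () then (1 : ℂ) else 0) = if X ⊆ B () then 1 else 0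
    simp only [Finset.smul_finset_subset_smul_finset_iff]
  | node l r ihl ihr =>
    change stringNode _ _ _ (blocks (g • leafL B)) (blocks (g • leafR B))
      (treeV l (intL k) (g • leafL B)) (treeV r (intR k) (g • leafR B)) (g • X) =
      stringNode _ _ _ _ _ _ _ _
    simp only [stringNode, blocks_smul, ← Finset.smul_finset_union, ← Finset.smul_finset_inter,
      Finset.smul_finset_subset_smul_finset_iff, Finset.card_smul_finset, ihl, ihr]

theorem treeV_conj (T : BTree) (k : Internal T → ℕ) (B : Leaf T → Finset α)
    (X : Finset α) : (starRingEnd ℂ) (treeV T k B X) = treeV T k B X := by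
  induction T generalizing X with
  | leaf =>
    change (starRingEnd ℂ) (if X ⊆ B () then (1 : ℂ) else 0) = if X ⊆ B () then 1 else 0
    split_ifs <;> simp
  | node l r ihl ihr =>
    change (starRingEnd ℂ) (stringNode _ _ _ _ _ _ _ X) = stringNode _ _ _ _ _ _ _ X
    simp only [stringNode]
    split_ifs
    · simp only [map_mul, ihl, ihr, map_intCast]
    · simp

theorem treeV_exists_ne_zero (T : BTree) (a : Leaf T → ℕ) (k : Internal T → ℕ)
    (hk : IsRepLabeling T a k) (Z : Finset α) (B : Leaf T → Finset α) (hB : B ∈ OmegaA a Z) :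
    ∃ X, X.card = repRoot T k ∧ treeV T k B X ≠ 0 := by
  induction T generalizing Z with
  | leaf => exact ⟨∅, rfl, by simp [treeV]⟩
  | node l r ihl ihr =>
    obtain ⟨hk1, hk2, hk3, hk4, hij, hkl, hkr⟩ := hk
    obtain ⟨h1, h2, h3⟩ := mem_OmegaA_node.1 hB
    have hR := blocks_eq h3
    rw [← hR] at h3
    have hc2 := card_of_mem_OmegaA h2
    have hc3 := card_of_mem_OmegaA h3
    obtain ⟨X, ⟨hX, _⟩, _, _, h⟩ := stringNode_ne_zero
      (κ := atRoot k - repRoot l (intL k) - repRoot r (intR k))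
      (treeV_isString l _ _ hkl _ _ h2) (treeV_isString r _ _ hkr _ _ h3)
      (hR ▸ Finset.disjoint_sdiff) (ihl _ _ hkl _ _ h2) (ihr _ _ hkr _ _ h3)
      (by rw [hc2]; omega) (by rw [hc3]; omega)
    refine ⟨X, ?_, h⟩
    change _ = atRoot k
    omega

/-- For a given `X` only `w = |X ∩ A''|` can contribute to the recursive sum, so `Φ` is the degree
`m` slice of the string. -/
theorem Phi_eq_treeV (T : BTree) (a : Leaf T → ℕ) (k : Internal T → ℕ)
    (hk : IsRepLabeling T a k) (Z : Finset α) (B : Leaf T → Finset α) (hB : B ∈ OmegaA a Z)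
    (m : ℕ) (X : Finset α) :
    Phi T a k m B X = if X.card = m then treeV T k B X else 0 := by
  induction T generalizing Z m X with
  | leaf =>
    change (if X ∈ (B ()).powersetCard m then (1 : ℂ) else 0) =
      if X.card = m then (if X ⊆ B () then 1 else 0) else 0
    simp only [Finset.mem_powersetCard]
    split_ifs <;> first | rfl | tauto
  | node l r ihl ihr =>
    have hstr := treeV_isString _ _ _ hk _ _ hB
    obtain ⟨hk1, hk2, hk3, hk4, hij, hkl, hkr⟩ := hk
    obtain ⟨h1, h2, h3⟩ := mem_OmegaA_node.1 hB
    have hR := blocks_eq h3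
    have hdis : Disjoint (blocks (leafL B)) (blocks (leafR B)) := hR ▸ Finset.disjoint_sdiff
    rw [← hR] at h3
    have hc2 := card_of_mem_OmegaA h2
    have hc3 := card_of_mem_OmegaA h3
    have hsL := treeV_isString l _ _ hkl _ _ h2
    have hsR := treeV_isString r _ _ hkr _ _ h3
    change (∑ w ∈ rootRange a k m, rootCoeff a k m w •
      setTens (blocks (leafL B)) (blocks (leafR B))
        (Phi l (leafL a) (intL k) (m - w) (leafL B))
        (Phi r (leafR a) (intR k) w (leafR B))) X =
      if X.card = m then stringNode _ _ _ _ _ _ _ X else 0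
    rw [Finset.sum_apply]
    simp only [Pi.smul_apply, setTens, stringNode, ihl _ _ hkl _ _ h2, ihr _ _ hkr _ _ h3,
      smul_eq_mul]
    by_cases hX : X ⊆ blocks (leafL B) ∪ blocks (leafR B)
    swap
    · simp [hX]
    simp only [if_pos hX]
    have hcard := card_eq_inter_add_inter hdis hX
    have hmem : ∀ w, w ∈ rootRange a k m ↔ w ≤ m ∧ repRoot r (intR k) ≤ w ∧
        repRoot l (intL k) + m ≤ total (leafL a) + w ∧ w + repRoot r (intR k) ≤ total (leafR a) ∧
        w + repRoot l (intL k) ≤ m := by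
      intro w
      simp only [rootRange, wRange, Finset.mem_filter, Finset.mem_range, max_le_iff, le_min_iff]
      omega
    by_cases hm : X.card = m
    swap
    · rw [if_neg hm]
      refine Finset.sum_eq_zero fun w hw => ?_
      rw [hmem] at hw
      by_cases e : (X ∩ blocks (leafR B)).card = w
      · rw [if_neg (c := _ = m - w) (by omega)]; simp
      · rw [if_neg e]; simp
    rw [if_pos hm]
    rw [Finset.sum_eq_single (X ∩ blocks (leafR B)).card]
    · have e : (X ∩ blocks (leafL B)).card = m - (X ∩ blocks (leafR B)).card := by omega
      rw [if_pos e, if_pos rfl, rootCoeff, hc2, hc3, hm, ← mul_assoc]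
    · intro w hw hne
      rw [if_neg (Ne.symm hne)]; simp
    · intro hw
      rw [hmem] at hw
      -- The bounds for `w` are exactly the degree ranges of the two strings, so a `w` that the sum
      -- omits has coefficient function zero.
      have : (X ∩ blocks (leafL B)).card < repRoot l (intL k) ∨
        (X ∩ blocks (leafR B)).card < repRoot r (intR k) ∨
        total (leafL a) < (X ∩ blocks (leafL B)).card + repRoot l (intL k) ∨
        total (leafR a) < (X ∩ blocks (leafR B)).card + repRoot r (intR k) := by omega
      rcases this with h | h | h | h
      · rw [hsL.eq_zero_of_card_lt _ h]; simp
      · rw [hsR.eq_zero_of_card_lt _ h]; simp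
      · rw [hsL.eq_zero_of_lt_card _ (by omega)]; simp
      · rw [hsR.eq_zero_of_lt_card _ (by omega)]; simp

end Partitions

/-! ### The functions `Ψ` and `Ξ` -/

theorem IsVarLabeling.le {T : BTree} {a : Leaf T → ℕ} {k : Internal T → ℕ} {m : ℕ}
    {w : Internal T → ℕ} (h : IsVarLabeling T a k m w) (v : Internal T) : w v ≤ m := by
  induction T generalizing m with
  | leaf => exact Empty.elim v
  | node l r ihl ihr =>
    obtain ⟨h1, h2, h3⟩ := h
    have h4 : atRoot w ≤ m := by
      have h5 := (Finset.mem_filter.1 h1).1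
      exact Nat.lt_succ_iff.1 (Finset.mem_range.1 h5)
    rcases v with _ | (v | v)
    · exact h4
    · exact (ihl h2 v).trans (Nat.sub_le _ _)
    · exact (ihr h3 v).trans h4

open Classical in
theorem mem_varLabelings {T : BTree} {a : Leaf T → ℕ} {k : Internal T → ℕ} {m : ℕ}
    {w : Internal T → ℕ} : w ∈ varLabelings T a k m ↔ IsVarLabeling T a k m w := by
  rw [varLabelings, Finset.mem_filter, Fintype.mem_piFinset]
  exact ⟨fun h => h.2, fun h => ⟨fun v => Finset.mem_range.2 (Nat.lt_succ_iff.2 (h.le v)), h⟩⟩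

/-- The labeling of the internal vertices with given root label and given restrictions. -/
def joinInt {l r : BTree} (w : ℕ) (wl : Internal l → ℕ) (wr : Internal r → ℕ) :
    Internal (.node l r) → ℕ
  | none => w
  | some (Sum.inl v) => wl v
  | some (Sum.inr v) => wr v

theorem joinInt_eta {l r : BTree} (w : Internal (.node l r) → ℕ) :
    joinInt (atRoot w) (intL w) (intR w) = w := by
  funext v
  rcases v with _ | (v | v) <;> rfl

theorem sum_varLabelings_node {l r : BTree} (a : Leaf (.node l r) → ℕ)
    (k : Internal (.node l r) → ℕ) (m : ℕ) (f : (Internal (.node l r) → ℕ) → ℂ) :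
    ∑ w ∈ varLabelings (.node l r) a k m, f w =
      ∑ w ∈ rootRange a k m, ∑ wl ∈ varLabelings l (leafL a) (intL k) (m - w),
        ∑ wr ∈ varLabelings r (leafR a) (intR k) w, f (joinInt w wl wr) := by
  simp only [← Finset.sum_product']
  rw [Finset.sum_sigma']
  refine Finset.sum_nbij' (fun w => ⟨atRoot w, (intL w, intR w)⟩)
    (fun x => joinInt x.1 x.2.1 x.2.2) ?_ ?_ ?_ ?_ ?_
  · intro w hw
    obtain ⟨h1, h2, h3⟩ := mem_varLabelings.1 hw
    exact Finset.mem_sigma.2 ⟨h1, Finset.mem_product.2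
      ⟨mem_varLabelings.2 h2, mem_varLabelings.2 h3⟩⟩
  · intro x hx
    obtain ⟨h1, h2⟩ := Finset.mem_sigma.1 hx
    obtain ⟨h3, h4⟩ := Finset.mem_product.1 h2
    exact mem_varLabelings.2 ⟨h1, mem_varLabelings.1 h3, mem_varLabelings.1 h4⟩
  · intro w _
    exact joinInt_eta w
  · intro x _
    rfl
  · intro w _
    exact congrArg f (joinInt_eta w).symm

section Psi

variable {α : Type} [DecidableEq α]

/-- Unfolding `Φ` down to the leaves gives a sum over variable labelings; each leaf contributes the
condition that `Y` meets its block in `x_s` points. No disjointness of the blocks is needed. -/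
theorem sum_varLabelings_eq_Phi (T : BTree) (a : Leaf T → ℕ) (k : Internal T → ℕ) (m : ℕ)
    (B : Leaf T → Finset α) (Y : Finset α) :
    ∑ w ∈ varLabelings T a k m, treeHahn T a k m w *
      (if ∀ s, (B s ∩ Y).card = leafValues T m w s then (1 : ℂ) else 0) =
      Phi T a k m B (Y ∩ blocks B) := by
  induction T generalizing m Y with
  | leaf =>
    let w₀ : Internal .leaf → ℕ := fun v => Empty.elim v
    have h1 : varLabelings .leaf a k m = {w₀} :=
      Finset.eq_singleton_iff_unique_mem.2
        ⟨mem_varLabelings.2 trivial, fun w _ => funext fun v => Empty.elim v⟩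
    rw [h1, Finset.sum_singleton, blocks_leaf]
    change 1 * _ = (if _ ∈ (B ()).powersetCard m then (1 : ℂ) else 0)
    simp only [Finset.mem_powersetCard, Finset.inter_subset_right, true_and, one_mul]
    have h2 : (∀ s, (B s ∩ Y).card = leafValues .leaf m w₀ s) ↔
        (Y ∩ B ()).card = m := by
      rw [Finset.inter_comm Y]
      exact ⟨fun h => h (), fun h s => h⟩
    simp only [h2]
  | node l r ihl ihr =>
    rw [sum_varLabelings_node]
    change _ = (∑ w ∈ rootRange a k m, rootCoeff a k m w •
      setTens (blocks (leafL B)) (blocks (leafR B))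
        (Phi l (leafL a) (intL k) (m - w) (leafL B))
        (Phi r (leafR a) (intR k) w (leafR B))) _
    rw [Finset.sum_apply]
    refine Finset.sum_congr rfl fun w _ => ?_
    rw [blocks_node]
    have e1 : Y ∩ (blocks (leafL B) ∪ blocks (leafR B)) ∩ blocks (leafL B) =
        Y ∩ blocks (leafL B) := by
      rw [Finset.inter_assoc, Finset.inter_eq_right.2 Finset.subset_union_left]
    have e2 : Y ∩ (blocks (leafL B) ∪ blocks (leafR B)) ∩ blocks (leafR B) =
        Y ∩ blocks (leafR B) := by
      rw [Finset.inter_assoc, Finset.inter_eq_right.2 Finset.subset_union_right]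
    simp only [Pi.smul_apply, setTens, Finset.inter_subset_right, if_true, smul_eq_mul, e1, e2]
    rw [← ihl, ← ihr, Finset.sum_mul_sum, Finset.mul_sum]
    refine Finset.sum_congr rfl fun wl _ => ?_
    rw [Finset.mul_sum]
    refine Finset.sum_congr rfl fun wr _ => ?_
    have h2 : (∀ s, (B s ∩ Y).card = leafValues (.node l r) m (joinInt w wl wr) s) ↔
        (∀ s, (leafL B s ∩ Y).card = leafValues l (m - w) wl s) ∧
        (∀ s, (leafR B s ∩ Y).card = leafValues r w wr s) := by
      constructor
      · intro h
        exact ⟨fun s => h (Sum.inl s), fun s => h (Sum.inr s)⟩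
      · rintro ⟨h, h'⟩ (s | s)
        · exact h s
        · exact h' s
    have h3 : treeHahn (.node l r) a k m (joinInt w wl wr) =
      rootCoeff a k m w * treeHahn l (leafL a) (intL k) (m - w) wl *
        treeHahn r (leafR a) (intR k) w wr := rfl
    rw [h3]
    simp only [h2]
    by_cases p1 : ∀ s, (leafL B s ∩ Y).card = leafValues l (m - w) wl s <;>
    by_cases p2 : ∀ s, (leafR B s ∩ Y).card = leafValues r w wr s <;>
    simp [p1, p2, mul_assoc]

open Classical in
theorem Psi_apply (T : BTree) (a : Leaf T → ℕ) (k : Internal T → ℕ) (m : ℕ)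
    (Z Y : Finset α) (B : Leaf T → Finset α) :
    Psi T a k m Z Y B = if B ∈ OmegaA a Z then Phi T a k m B (Y ∩ Z) else 0 := by
  rw [Psi, Finset.sum_apply]
  split_ifs with h
  · have hb := blocks_eq h
    subst hb
    rw [← sum_varLabelings_eq_Phi]
    refine Finset.sum_congr rfl fun w _ => ?_
    simp [sigmaA, h]
  · exact Finset.sum_eq_zero fun w _ => by simp [sigmaA, h]

open Classical in
-- At a partition `B` only the summand with `F` equal to the union of the left blocks can be
-- nonzero.
theorem Xi_apply (l r : BTree) (a : Leaf (.node l r) → ℕ) (k : Internal (.node l r) → ℕ)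
    (m w : ℕ) (Z Y : Finset α) (B : Leaf (.node l r) → Finset α) :
    Xi l r a k m w Z Y B =
      if B ∈ OmegaA a Z ∧ (blocks (leafL B) ∩ Y).card = m - w then
        Phi l (leafL a) (intL k) (m - w) (leafL B) (blocks (leafL B) ∩ Y) *
        Phi r (leafR a) (intR k) w (leafR B) ((Z \ blocks (leafL B)) ∩ Y) else 0 := by
  rw [Xi, Finset.sum_apply]
  simp only [tens, Psi_apply]
  have e : ∀ U : Finset α, U ∩ Y ∩ U = U ∩ Y := fun U => by
    rw [Finset.inter_right_comm, Finset.inter_self]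
  simp only [e]
  split_ifs with h
  · obtain ⟨h1, h2, h3⟩ := mem_OmegaA_node.1 h.1
    rw [Finset.sum_eq_single (blocks (leafL B))]
    · rw [if_pos h2, if_pos h3]
    · intro F _ hF
      rw [if_neg fun hh => hF (blocks_eq hh).symm, zero_mul]
    · intro hn
      exfalso
      apply hn
      rw [Finset.mem_filter, Finset.mem_powersetCard]
      exact ⟨⟨h1, card_of_mem_OmegaA h2⟩, h.2⟩
  · refine Finset.sum_eq_zero fun F hF => ?_
    obtain ⟨hF1, hF2⟩ := Finset.mem_filter.1 hF
    by_cases h2 : leafL B ∈ OmegaA (leafL a) F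
    · by_cases h3 : leafR B ∈ OmegaA (leafR a) (Z \ F)
      · obtain ⟨h4, rfl⟩ := (mem_OmegaA_node_iff (Finset.mem_powersetCard.1 hF1).1).2 ⟨h2, h3⟩
        exact (h ⟨h4, hF2⟩).elim
      · rw [if_neg h3, mul_zero]
    · rw [if_neg h2, zero_mul]

theorem Psi_eq_sum_Xi (l r : BTree) (a : Leaf (.node l r) → ℕ) (k : Internal (.node l r) → ℕ)
    (hk : IsRepLabeling (.node l r) a k) (m : ℕ) (Z Y : Finset α) :
    Psi (.node l r) a k m Z Y =
      ∑ w ∈ rootRange a k m, rootCoeff a k m w • Xi l r a k m w Z Y := by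
  classical
  funext B
  rw [Psi_apply, Finset.sum_apply]
  simp only [Pi.smul_apply, Xi_apply, smul_eq_mul]
  split_ifs with h
  · obtain ⟨_, _, _, _, _, hkl, hkr⟩ := hk
    obtain ⟨h1, h2, h3⟩ := mem_OmegaA_node.1 h
    have hZ := (blocks_node B).symm.trans (blocks_eq h)
    have hR := blocks_eq h3
    change (∑ w ∈ rootRange a k m, rootCoeff a k m w •
      setTens (blocks (leafL B)) (blocks (leafR B))
        (Phi l (leafL a) (intL k) (m - w) (leafL B))
        (Phi r (leafR a) (intR k) w (leafR B))) _ = _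
    rw [Finset.sum_apply]
    refine Finset.sum_congr rfl fun w _ => ?_
    rw [Pi.smul_apply, setTens, if_pos (hZ.symm ▸ Finset.inter_subset_right), smul_eq_mul,
      Finset.inter_assoc, Finset.inter_assoc, Finset.inter_eq_right.2 h1, hR,
      Finset.inter_eq_right.2 Finset.sdiff_subset, Finset.inter_comm Y, Finset.inter_comm Y]
    congr 1
    -- The restriction on `|F ∩ Y|` in `Ξ` loses nothing, because the left factor `Φ` is supported
    -- on sets of size `m - w`.
    by_cases hc : (blocks (leafL B) ∩ Y).card = m - w
    · rw [if_pos ⟨h, hc⟩]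
    · rw [if_neg fun hh => hc hh.2, Phi_eq_treeV l _ _ hkl _ _ h2, if_neg hc, zero_mul]
  · refine (Finset.sum_eq_zero fun w _ => ?_).symm
    rw [if_neg fun hh => h hh.1, mul_zero]

end Psi

/-! ### Functions on subsets that are invariant under transpositions -/

section Swaps

variable {α : Type} [DecidableEq α]

/-- Invariance under the transpositions of elements of `X`. -/
def SwapInv {Ω β : Type*} [SMul (Equiv.Perm α) Ω] (X : Finset α) (u : Ω → β) : Prop :=
  ∀ x ∈ X, ∀ y ∈ X, ∀ C, u (Equiv.swap x y • C) = u C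

theorem swap_smul_finset {x y : α} {C : Finset α} (hx : x ∈ C) (hy : y ∉ C) :
    Equiv.swap x y • C = insert y (C.erase x) := by
  ext z
  rw [← Finset.inv_smul_mem_iff, Equiv.swap_inv, Equiv.Perm.smul_def, Finset.mem_insert,
    Finset.mem_erase]
  rcases eq_or_ne z x with rfl | hzx
  · rw [Equiv.swap_apply_left]
    constructor
    · exact fun h => (hy h).elim
    · rintro (h | h)
      · exact (hy (h ▸ hx)).elim
      · exact (h.1 rfl).elim
  · rcases eq_or_ne z y with rfl | hzy
    · rw [Equiv.swap_apply_right]; simp [hx]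
    · rw [Equiv.swap_apply_of_ne_of_ne hzx hzy]; simp [hzx, hzy]

theorem swap_smul_eq_self {x y : α} {C : Finset α} (h : x ∈ C ↔ y ∈ C) :
    Equiv.swap x y • C = C := by
  ext z
  rw [← Finset.inv_smul_mem_iff, Equiv.swap_inv, Equiv.Perm.smul_def]
  rcases eq_or_ne z x with rfl | hzx
  · rw [Equiv.swap_apply_left, h]
  · rcases eq_or_ne z y with rfl | hzy
    · rw [Equiv.swap_apply_right, h]
    · rw [Equiv.swap_apply_of_ne_of_ne hzx hzy]

theorem swap_mem_symOn {x y : α} {Z : Finset α} (hx : x ∈ Z) (hy : y ∈ Z) :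
    Equiv.swap x y ∈ symOn Z := fun _ hz =>
  Equiv.swap_apply_of_ne_of_ne (fun h => hz (h ▸ hx)) (fun h => hz (h ▸ hy))

/-- Exchanging a point of `C \ D` with one of `D \ C` brings `C` closer to `D`. Values in any sort
are allowed, so that invariant propositions can be transported too. -/
theorem SwapInv.eq_of_card_eq {β : Sort*} {X : Finset α} {u : Finset α → β}
    (h : ∀ x ∈ X, ∀ y ∈ X, ∀ C, u (Equiv.swap x y • C) = u C) {C D : Finset α}
    (hCD : C \ X = D \ X) (hcard : C.card = D.card) : u C = u D := by
  induction hn : (C \ D).card generalizing C with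
  | zero =>
    rw [Finset.card_eq_zero, Finset.sdiff_eq_empty_iff_subset] at hn
    rw [Finset.eq_of_subset_of_card_le hn hcard.ge]
  | succ n ih =>
    have hn' : (D \ C).card = n + 1 := by rw [← hn, Finset.card_sdiff_comm hcard]
    obtain ⟨x, hx⟩ := Finset.card_pos.1 (by omega : 0 < (C \ D).card)
    obtain ⟨y, hy⟩ := Finset.card_pos.1 (by omega : 0 < (D \ C).card)
    obtain ⟨hxC, hxD⟩ := Finset.mem_sdiff.1 hx
    obtain ⟨hyD, hyC⟩ := Finset.mem_sdiff.1 hy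
    have hxX : x ∈ X := by
      by_contra hxX
      exact hxD (Finset.mem_sdiff.1 (hCD ▸ Finset.mem_sdiff.2 ⟨hxC, hxX⟩)).1
    have hyX : y ∈ X := by
      by_contra hyX
      exact hyC (Finset.mem_sdiff.1 (hCD.symm ▸ Finset.mem_sdiff.2 ⟨hyD, hyX⟩)).1
    rw [← h x hxX y hyX C]
    have hs := swap_smul_finset hxC hyC
    apply ih
    · rw [hs, ← hCD]
      ext z
      simp only [Finset.mem_sdiff, Finset.mem_insert, Finset.mem_erase]
      constructor
      · rintro ⟨rfl | h1, h2⟩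
        · exact (h2 hyX).elim
        · exact ⟨h1.2, h2⟩
      · rintro ⟨h1, h2⟩
        exact ⟨Or.inr ⟨fun h => h2 (h ▸ hxX), h1⟩, h2⟩
    · rw [Finset.card_smul_finset, hcard]
    · rw [hs, Finset.insert_sdiff_of_mem _ hyD, Finset.erase_sdiff_comm,
        Finset.card_erase_of_mem hx, hn]
      rfl

set_option linter.unusedSectionVars false

theorem one_mem_symOn (Z : Finset α) : (1 : Equiv.Perm α) ∈ symOn Z := fun _ _ => rfl

theorem mul_mem_symOn {Z : Finset α} {g h : Equiv.Perm α} (hg : g ∈ symOn Z)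
    (hh : h ∈ symOn Z) : g * h ∈ symOn Z := fun x hx => by
  rw [Equiv.Perm.mul_apply, hh x hx, hg x hx]

theorem inv_mem_symOn {Z : Finset α} {g : Equiv.Perm α} (hg : g ∈ symOn Z) :
    g⁻¹ ∈ symOn Z := fun x hx => by
  rw [Equiv.Perm.inv_eq_iff_eq, hg x hx]

theorem smul_eq_of_mem_symOn {Z : Finset α} {g : Equiv.Perm α} (hg : g ∈ symOn Z) :
    g • Z = Z := by
  apply Finset.eq_of_subset_of_card_le
  · intro y hy
    obtain ⟨x, hx, rfl⟩ := Finset.mem_smul_finset.1 hy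
    by_contra h
    have h2 := g.injective (hg _ h)
    rw [Equiv.Perm.smul_def] at h
    rw [h2] at h
    exact h hx
  · rw [Finset.card_smul_finset]

theorem exists_mem_symOn_smul_eq {Z C D : Finset α} (hC : C ⊆ Z) (hD : D ⊆ Z)
    (hcard : C.card = D.card) : ∃ g ∈ symOn Z, g • C = D := by
  -- Membership in the orbit of `C` is a transposition-invariant proposition; it holds at `C`, hence
  -- at `D`.
  have h := SwapInv.eq_of_card_eq (X := Z) (u := fun E => ∃ g ∈ symOn Z, g • C = E) ?_
    (C := C) (D := D) (by rw [Finset.sdiff_eq_empty_iff_subset.2 hC,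
      Finset.sdiff_eq_empty_iff_subset.2 hD]) hcard
  · exact h.mp ⟨1, one_mem_symOn Z, one_smul _ _⟩
  · intro x hx y hy E
    apply propext
    constructor
    · rintro ⟨g, hg, h⟩
      refine ⟨Equiv.swap x y * g, mul_mem_symOn (swap_mem_symOn hx hy) hg, ?_⟩
      rw [mul_smul, h, ← mul_smul, Equiv.swap_mul_self, one_smul]
    · rintro ⟨g, hg, h⟩
      refine ⟨Equiv.swap x y * g, mul_mem_symOn (swap_mem_symOn hx hy) hg, ?_⟩
      rw [mul_smul, h]

end Swaps

/-! ### The representations `S^{n-k,k}` -/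

section Johnson

variable {α : Type} [Fintype α] [DecidableEq α]

set_option linter.unusedSectionVars false

theorem permRep_apply {X : Type} [MulAction (Equiv.Perm α) X] (g : Equiv.Perm α) (f : X → ℂ)
    (x : X) : permRep X g f x = f (g⁻¹ • x) := rfl

theorem mem_johnsonS_iff {Z : Finset α} {k : ℕ} {f : Finset α → ℂ} :
    f ∈ johnsonS Z k ↔ (∀ C, ¬(C ⊆ Z ∧ C.card = k) → f C = 0) ∧
      ∀ C, C ⊆ Z → C.card + 1 = k → ∑ x ∈ Z \ C, f (insert x C) = 0 := by
  rw [johnsonS, Submodule.mem_inf]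
  have h1 : f ∈ johnsonM Z k ↔ ∀ C, ¬(C ⊆ Z ∧ C.card = k) → f C = 0 := by
    change (∀ C, C ∉ Z.powersetCard k → f C = 0) ↔ _
    simp only [Finset.mem_powersetCard]
  rw [h1, LinearMap.mem_ker]
  refine and_congr_right fun hM => ?_
  have h2 : ∀ C : Finset α, C ⊆ Z →
      ∑ x ∈ Cᶜ, f (insert x C) = ∑ x ∈ Z \ C, f (insert x C) := by
    intro C hC
    refine (Finset.sum_subset (fun x hx => ?_) fun x hx hx' => ?_).symm
    · exact Finset.mem_compl.2 (Finset.mem_sdiff.1 hx).2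
    · refine hM _ fun h => hx' (Finset.mem_sdiff.2 ⟨h.1 (Finset.mem_insert_self _ _),
        Finset.mem_compl.1 hx⟩)
  constructor
  · intro h C hC _
    rw [← h2 C hC]
    exact congrFun h C
  · intro h
    funext C
    change ∑ x ∈ Cᶜ, f (insert x C) = 0
    by_cases hC : C ⊆ Z
    · by_cases hk : C.card + 1 = k
      · rw [h2 C hC]; exact h C hC hk
      · refine Finset.sum_eq_zero fun x hx => hM _ fun hh => hk ?_
        rw [← hh.2, Finset.card_insert_of_notMem (Finset.mem_compl.1 hx)]
    · exact Finset.sum_eq_zero fun x _ => hM _ fun hh =>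
        hC ((Finset.subset_insert x C).trans hh.1)

/-- Induction on `|C \ X|`. In the relation attached to `C` without a point outside `X`, completions
by points of `X` vanish by induction and all others have the value `u C`, leaving a positive
multiple of `u C`. -/
theorem eq_zero_of_vanish_subsets {Z X : Finset α} {k : ℕ} {u : Finset α → ℂ}
    (hu : u ∈ johnsonS Z k) (hinv : SwapInv (Z \ X) u)
    (h0 : ∀ C, C ⊆ X → C.card = k → u C = 0) : u = 0 := by
  obtain ⟨hM, hd⟩ := mem_johnsonS_iff.1 hu
  funext C
  by_cases hC : C ⊆ Z ∧ C.card = k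
  swap
  · exact hM C hC
  induction hn : (C \ X).card using Nat.strong_induction_on generalizing C with
  | _ n ih =>
    obtain ⟨hCZ, hCk⟩ := hC
    rcases Finset.eq_empty_or_nonempty (C \ X) with he | ⟨x, hx⟩
    · exact h0 C (Finset.sdiff_eq_empty_iff_subset.1 he) hCk
    obtain ⟨hxC, hxX⟩ := Finset.mem_sdiff.1 hx
    have hpos := Finset.card_pos.2 ⟨x, hxC⟩
    have hrel := hd (C.erase x) ((Finset.erase_subset _ _).trans hCZ)
      (by rw [Finset.card_erase_of_mem hxC]; omega)
    have hval : ∀ y ∈ Z \ C.erase x,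
        u (insert y (C.erase x)) = if y ∈ X then 0 else u C := by
      intro y hy
      obtain ⟨hyZ, hyC⟩ := Finset.mem_sdiff.1 hy
      split_ifs with hyX
      · refine ih _ ?_ (insert y (C.erase x)) ⟨Finset.insert_subset hyZ
          ((Finset.erase_subset _ _).trans hCZ), ?_⟩ rfl
        · rw [Finset.insert_sdiff_of_mem _ hyX, Finset.erase_sdiff_comm,
            Finset.card_erase_of_mem hx]
          have := Finset.card_pos.2 ⟨x, hx⟩
          omega
        · rw [Finset.card_insert_of_notMem hyC, Finset.card_erase_of_mem hxC]; omega
      · rcases eq_or_ne y x with rfl | hyx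
        · rw [Finset.insert_erase hxC]
        · have hyC' : y ∉ C := fun h => hyC (Finset.mem_erase.2 ⟨hyx, h⟩)
          rw [← swap_smul_finset hxC hyC']
          exact hinv x (Finset.mem_sdiff.2 ⟨hCZ hxC, hxX⟩) y (Finset.mem_sdiff.2 ⟨hyZ, hyX⟩) C
    rw [Finset.sum_congr rfl hval, Finset.sum_ite, Finset.sum_const_zero, zero_add,
      Finset.sum_const, nsmul_eq_mul] at hrel
    refine (mul_eq_zero.1 hrel).resolve_left ?_
    have : 0 < ((Z \ C.erase x).filter fun y => y ∉ X).card :=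
      Finset.card_pos.2 ⟨x, Finset.mem_filter.2 ⟨Finset.mem_sdiff.2 ⟨hCZ hxC,
        Finset.notMem_erase _ _⟩, hxX⟩⟩
    exact_mod_cast this.ne'

/-- Invariance on `X` makes `u` constant on the `k`-subsets of `X`, and that constant determines
`u`. -/
theorem exists_smul_eq_of_swapInv {Z X : Finset α} {k : ℕ} {u v : Finset α → ℂ}
    (hu : u ∈ johnsonS Z k) (hv : v ∈ johnsonS Z k) (hv0 : v ≠ 0)
    (hu1 : SwapInv X u) (hu2 : SwapInv (Z \ X) u)
    (hv1 : SwapInv X v) (hv2 : SwapInv (Z \ X) v) : ∃ c : ℂ, u = c • v := by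
  obtain ⟨C, hCX, hCk, hC⟩ : ∃ C, C ⊆ X ∧ C.card = k ∧ v C ≠ 0 := by
    by_contra! h
    exact hv0 (eq_zero_of_vanish_subsets hv hv2 h)
  refine ⟨u C / v C, sub_eq_zero.1 (eq_zero_of_vanish_subsets (X := X)
    (Submodule.sub_mem _ hu (Submodule.smul_mem _ _ hv)) ?_ ?_)⟩
  · intro x hx y hy D
    simp only [Pi.sub_apply, Pi.smul_apply, hu2 x hx y hy, hv2 x hx y hy]
  · intro D hDX hDk
    have e : D \ X = C \ X := by
      rw [Finset.sdiff_eq_empty_iff_subset.2 hDX, Finset.sdiff_eq_empty_iff_subset.2 hCX]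
    have h1 := SwapInv.eq_of_card_eq hu1 e (hDk.trans hCk.symm)
    have h2 := SwapInv.eq_of_card_eq hv1 e (hDk.trans hCk.symm)
    rw [Pi.sub_apply, Pi.smul_apply, h1, h2, smul_eq_mul, div_mul_cancel₀ _ hC, sub_self]

/-! ### The reproducing kernel of `S^{n-k,k}` -/

theorem herm_add_left (f f' g : Finset α → ℂ) : herm (f + f') g = herm f g + herm f' g := by
  simp [herm, add_mul, Finset.sum_add_distrib]

theorem herm_smul_left (c : ℂ) (f g : Finset α → ℂ) : herm (c • f) g = c * herm f g := by
  simp [herm, Finset.mul_sum, mul_assoc]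

theorem herm_sub_right (f g g' : Finset α → ℂ) : herm f (g - g') = herm f g - herm f g' := by
  simp [herm, mul_sub, Finset.sum_sub_distrib]

theorem herm_sum_right {ι : Type*} (s : Finset ι) (f : Finset α → ℂ) (g : ι → Finset α → ℂ) :
    herm f (∑ i ∈ s, g i) = ∑ i ∈ s, herm f (g i) := by
  simp only [herm, Finset.sum_apply, map_sum, Finset.mul_sum]
  exact Finset.sum_comm

theorem herm_smul_right (c : ℂ) (f g : Finset α → ℂ) :
    herm f (c • g) = (starRingEnd ℂ) c * herm f g := by
  simp only [herm, Pi.smul_apply, smul_eq_mul, map_mul, Finset.mul_sum]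
  exact Finset.sum_congr rfl fun C _ => by ring

theorem herm_conj (f g : Finset α → ℂ) : (starRingEnd ℂ) (herm f g) = herm g f := by
  simp only [herm, map_sum, map_mul, Complex.conj_conj]
  exact Finset.sum_congr rfl fun C _ => mul_comm _ _

theorem eq_zero_of_herm_self {f : Finset α → ℂ} (h : herm f f = 0) : f = 0 := by
  have h1 : herm f f = ((∑ C, Complex.normSq (f C) : ℝ) : ℂ) := by
    rw [herm, Complex.ofReal_sum]
    exact Finset.sum_congr rfl fun C _ => Complex.mul_conj _
  rw [h1, Complex.ofReal_eq_zero,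
    Finset.sum_eq_zero_iff_of_nonneg fun C _ => Complex.normSq_nonneg _] at h
  funext C
  exact Complex.normSq_eq_zero.1 (h C (Finset.mem_univ C))

theorem herm_permRep (g : Equiv.Perm α) (f f' : Finset α → ℂ) :
    herm (permRep (Finset α) g f) (permRep (Finset α) g f') = herm f f' := by
  simp only [herm, permRep_apply]
  exact Fintype.sum_equiv (MulAction.toPerm g⁻¹) _ _ fun C => rfl

theorem permRep_inv_self {X : Type} [MulAction (Equiv.Perm α) X] (g : Equiv.Perm α) (f : X → ℂ) :
    permRep X g (permRep X g⁻¹ f) = f := by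
  funext x
  rw [permRep_apply, permRep_apply, inv_inv, smul_inv_smul]

theorem eq_of_herm_eq {S : Submodule ℂ (Finset α → ℂ)} {f g : Finset α → ℂ} (hf : f ∈ S)
    (hg : g ∈ S) (h : ∀ u ∈ S, herm u f = herm u g) : f = g := by
  rw [← sub_eq_zero]
  apply eq_zero_of_herm_self
  rw [herm_sub_right, h _ (S.sub_mem hf hg), sub_self]

theorem exists_reproducing (S : Submodule ℂ (Finset α → ℂ)) (Y : Finset α) :
    ∃ s ∈ S, ∀ u ∈ S, herm u s = u Y := by
  let φ := WithLp.linearEquiv 2 ℂ (Finset α → ℂ)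
  let S' : Submodule ℂ (EuclideanSpace ℂ (Finset α)) := S.comap φ.toLinearMap
  let δ : EuclideanSpace ℂ (Finset α) := EuclideanSpace.single Y 1
  refine ⟨φ (S'.starProjection δ), (S'.starProjection_apply_mem δ), fun u hu => ?_⟩
  have hu' : φ.symm u ∈ S' := by
    change φ (φ.symm u) ∈ S
    rwa [LinearEquiv.apply_symm_apply]
  have h := Submodule.starProjection_inner_eq_zero (K := S') δ (φ.symm u) hu'
  rw [inner_sub_left, sub_eq_zero, EuclideanSpace.inner_single_left] at h
  -- The arguments are exchanged because `herm` is linear in its first argument and `inner` in its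
  -- second.
  have h2 : herm u (φ (S'.starProjection δ)) = inner ℂ (S'.starProjection δ) (φ.symm u) := by
    rw [PiLp.inner_apply, herm]
    rfl
  rw [h2, ← h, map_one, one_mul]
  rfl

/-- The orthogonal projection of the delta function of `Y` to `S^{n-k,k}(Z)`. -/
def kernelS (Z : Finset α) (k : ℕ) (Y : Finset α) : Finset α → ℂ :=
  (exists_reproducing (johnsonS Z k) Y).choose

theorem kernelS_mem (Z : Finset α) (k : ℕ) (Y : Finset α) : kernelS Z k Y ∈ johnsonS Z k :=
  (exists_reproducing (johnsonS Z k) Y).choose_spec.1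

theorem herm_kernelS {Z : Finset α} {k : ℕ} {u : Finset α → ℂ} (hu : u ∈ johnsonS Z k)
    (Y : Finset α) : herm u (kernelS Z k Y) = u Y :=
  (exists_reproducing (johnsonS Z k) Y).choose_spec.2 u hu

/-- Pairing with `u` turns this into the equation `d u = 0` at `Y`. These relations among the
kernels drive the multiplicity-one argument. -/
theorem sum_kernelS_insert {Z : Finset α} {k : ℕ} {Y : Finset α} (hY : Y ⊆ Z)
    (hk : Y.card + 1 = k) : ∑ x ∈ Z \ Y, kernelS Z k (insert x Y) = 0 := by
  refine eq_of_herm_eq (Submodule.sum_mem _ fun x _ => kernelS_mem _ _ _)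
    (johnsonS Z k).zero_mem fun u hu => ?_
  rw [herm_sum_right]
  simp only [herm_kernelS hu]
  rw [(mem_johnsonS_iff.1 hu).2 Y hY hk]
  simp [herm]

theorem kernelS_eq_zero {Z : Finset α} {k : ℕ} {Y : Finset α} (hY : ¬(Y ⊆ Z ∧ Y.card = k)) :
    kernelS Z k Y = 0 := by
  refine eq_of_herm_eq (kernelS_mem _ _ _) (johnsonS Z k).zero_mem fun u hu => ?_
  rw [herm_kernelS hu, (mem_johnsonS_iff.1 hu).1 Y hY]
  simp [herm]

theorem permRep_kernelS {Z : Finset α} {k : ℕ} {g : Equiv.Perm α} (hg : g ∈ symOn Z)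
    (Y : Finset α) : permRep (Finset α) g (kernelS Z k Y) = kernelS Z k (g • Y) := by
  refine eq_of_herm_eq (permRep_mem_johnsonS Z k hg (kernelS_mem _ _ _)) (kernelS_mem _ _ _)
    fun u hu => ?_
  rw [herm_kernelS hu, ← permRep_inv_self g u, herm_permRep,
    herm_kernelS (permRep_mem_johnsonS Z k (inv_mem_symOn hg) hu), permRep_inv_self,
    permRep_apply, inv_inv]

theorem sum_smul_kernelS {Z : Finset α} {k : ℕ} {u : Finset α → ℂ} (hu : u ∈ johnsonS Z k) :
    ∑ Y, u Y • kernelS Z k Y = u := by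
  refine eq_of_herm_eq (Submodule.sum_mem _ fun x _ => Submodule.smul_mem _ _ (kernelS_mem _ _ _))
    hu fun v hv => ?_
  rw [herm_sum_right]
  simp only [herm_smul_right, herm_kernelS hv]
  exact Finset.sum_congr rfl fun C _ => mul_comm _ _

theorem swapInv_of_permRep {X : Type} [MulAction (Equiv.Perm α) X] {Z : Finset α} {f : X → ℂ}
    (h : ∀ x ∈ Z, ∀ y ∈ Z, permRep X (Equiv.swap x y) f = f) : SwapInv Z f := by
  intro x hx y hy C
  have h1 := congrFun (h x hx y hy) C
  rwa [permRep_apply, Equiv.swap_inv] at h1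

/-- Irreducibility. Averaging `f` over the stabilizer of a set `C` with `f C ≠ 0` gives a nonzero
invariant vector of `W`. The kernel at `C` is invariant too, hence a multiple of it and in `W`; the
translates of this kernel span `S^{n-k,k}`. -/
theorem johnsonS_le_of_invariant {Z : Finset α} {k : ℕ} {W : Submodule ℂ (Finset α → ℂ)}
    (hW : ∀ g ∈ symOn Z, ∀ f ∈ W, permRep (Finset α) g f ∈ W) {f : Finset α → ℂ}
    (hf : f ∈ johnsonS Z k) (hfW : f ∈ W) (hf0 : f ≠ 0) : johnsonS Z k ≤ W := by
  classical
  obtain ⟨C, hC⟩ := Function.ne_iff.1 hf0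
  have hCZ : C ⊆ Z ∧ C.card = k := by
    by_contra h
    exact hC ((mem_johnsonS_iff.1 hf).1 C h)
  let G : Finset (Equiv.Perm α) := Finset.univ.filter fun g => g ∈ symOn Z ∧ g • C = C
  have hG : ∀ g, g ∈ G ↔ g ∈ symOn Z ∧ g • C = C := fun g => by simp [G]
  let v : Finset α → ℂ := ∑ g ∈ G, permRep (Finset α) g f
  have hvS : v ∈ johnsonS Z k :=
    Submodule.sum_mem _ fun g hg => permRep_mem_johnsonS Z k ((hG g).1 hg).1 hf
  have hvW : v ∈ W := Submodule.sum_mem _ fun g hg => hW g ((hG g).1 hg).1 f hfW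
  have hvinv : ∀ g ∈ G, permRep (Finset α) g v = v := by
    intro g hg
    change permRep (Finset α) g (∑ h ∈ G, permRep (Finset α) h f) = _
    rw [map_sum]
    refine Finset.sum_nbij' (fun h => g * h) (fun h => g⁻¹ * h) ?_ ?_ ?_ ?_ ?_
    · intro h hh
      rw [hG] at hg hh ⊢
      exact ⟨mul_mem_symOn hg.1 hh.1, by rw [mul_smul, hh.2, hg.2]⟩
    · intro h hh
      rw [hG] at hg hh ⊢
      exact ⟨mul_mem_symOn (inv_mem_symOn hg.1) hh.1, by
        rw [mul_smul, hh.2, inv_smul_eq_iff, hg.2]⟩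
    · intro h _; exact inv_mul_cancel_left _ _
    · intro h _; exact mul_inv_cancel_left _ _
    · intro h _
      rw [map_mul]; rfl
  have hvC : v C = G.card * f C := by
    change (∑ g ∈ G, permRep (Finset α) g f) C = _
    rw [Finset.sum_apply, Finset.sum_congr rfl (g := fun _ => f C), Finset.sum_const,
      nsmul_eq_mul]
    intro g hg
    rw [permRep_apply, inv_smul_eq_iff.2 ((hG g).1 hg).2.symm]
  have hv0 : v ≠ 0 := by
    intro h
    have h1 : v C = 0 := by rw [h]; rfl
    rw [hvC] at h1
    have h2 : 0 < G.card := Finset.card_pos.2 ⟨1, (hG 1).2 ⟨one_mem_symOn Z, one_smul _ _⟩⟩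
    rcases mul_eq_zero.1 h1 with h3 | h3
    · exact h2.ne' (by exact_mod_cast h3)
    · exact hC h3
  have hsw : ∀ x y, (x ∈ C ∧ y ∈ C) ∨ (x ∈ Z \ C ∧ y ∈ Z \ C) → Equiv.swap x y ∈ G := by
    intro x y h
    rw [hG]
    rcases h with ⟨hx, hy⟩ | ⟨hx, hy⟩
    · exact ⟨swap_mem_symOn (hCZ.1 hx) (hCZ.1 hy), swap_smul_eq_self (by tauto)⟩
    · rw [Finset.mem_sdiff] at hx hy
      exact ⟨swap_mem_symOn hx.1 hy.1, swap_smul_eq_self (by tauto)⟩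
  have hkinv : ∀ g ∈ G, permRep (Finset α) g (kernelS Z k C) = kernelS Z k C := by
    intro g hg
    rw [permRep_kernelS ((hG g).1 hg).1, ((hG g).1 hg).2]
  obtain ⟨c, hc⟩ := exists_smul_eq_of_swapInv (kernelS_mem Z k C) hvS hv0
    (swapInv_of_permRep fun x hx y hy => hkinv _ (hsw x y (Or.inl ⟨hx, hy⟩)))
    (swapInv_of_permRep fun x hx y hy => hkinv _ (hsw x y (Or.inr ⟨hx, hy⟩)))
    (swapInv_of_permRep fun x hx y hy => hvinv _ (hsw x y (Or.inl ⟨hx, hy⟩)))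
    (swapInv_of_permRep fun x hx y hy => hvinv _ (hsw x y (Or.inr ⟨hx, hy⟩)))
  have hkW : kernelS Z k C ∈ W := hc ▸ W.smul_mem c hvW
  intro u hu
  rw [← sum_smul_kernelS hu]
  refine W.sum_mem fun Y _ => W.smul_mem _ ?_
  by_cases hY : Y ⊆ Z ∧ Y.card = k
  · obtain ⟨g, hg, rfl⟩ := exists_mem_symOn_smul_eq hCZ.1 hY.1 (hCZ.2.trans hY.2.symm)
    rw [← permRep_kernelS hg]
    exact hW g hg _ hkW
  · rw [kernelS_eq_zero hY]; exact W.zero_mem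

end Johnson

/-! ### The intertwining operator of a tree and its range -/

section TreeOperator

variable {α : Type} [Fintype α] [DecidableEq α]

set_option linter.unusedSectionVars false

/-- The vector `Φ(T(a), k, T_r(k))`, where `k` is the root label. -/
def treeVec (T : BTree) (k : Internal T → ℕ) (B : Leaf T → Finset α) : Finset α → ℂ :=
  fun C => if C.card = repRoot T k then treeV T k B C else 0

open Classical in
/-- The intertwining operator with values `⟨u, Φ⟩`. -/
def treeT (T : BTree) (a : Leaf T → ℕ) (k : Internal T → ℕ) (Z : Finset α) :
    (Finset α → ℂ) →ₗ[ℂ] ((Leaf T → Finset α) → ℂ) where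
  toFun u B := if B ∈ OmegaA a Z then herm u (treeVec T k B) else 0
  map_add' u v := by
    funext B
    simp only [Pi.add_apply, herm_add_left]
    split_ifs <;> simp
  map_smul' c u := by
    funext B
    simp only [Pi.smul_apply, herm_smul_left, RingHom.id_apply, smul_eq_mul]
    split_ifs <;> simp

/-- The image of `S^{n-k,k}(Z)` under the intertwining operator. -/
def treeR (T : BTree) (a : Leaf T → ℕ) (k : Internal T → ℕ) (Z : Finset α) :
    Submodule ℂ ((Leaf T → Finset α) → ℂ) :=
  (johnsonS Z (repRoot T k)).map (treeT T a k Z)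

open Classical in
/-- The function `Ψ` for the subset `Y` and the space label `|Y|`. -/
def treePsi (T : BTree) (a : Leaf T → ℕ) (k : Internal T → ℕ) (Z Y : Finset α) :
    (Leaf T → Finset α) → ℂ :=
  fun B => if B ∈ OmegaA a Z then treeV T k B Y else 0

theorem treePsi_of_mem {T : BTree} {a : Leaf T → ℕ} (k : Internal T → ℕ) {Z : Finset α}
    (Y : Finset α) {B : Leaf T → Finset α} (hB : B ∈ OmegaA a Z) :
    treePsi T a k Z Y B = treeV T k B Y := if_pos hB

theorem treePsi_of_notMem {T : BTree} {a : Leaf T → ℕ} (k : Internal T → ℕ) {Z : Finset α}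
    (Y : Finset α) {B : Leaf T → Finset α} (hB : B ∉ OmegaA a Z) :
    treePsi T a k Z Y B = 0 := if_neg hB

variable {T : BTree} {a : Leaf T → ℕ} {k : Internal T → ℕ} {Z : Finset α}

theorem treeR_le_moduleM : treeR T a k Z ≤ moduleM a Z := by
  rintro _ ⟨u, _, rfl⟩ B hB
  exact if_neg hB

theorem treeVec_mem (hk : IsRepLabeling T a k) {B : Leaf T → Finset α} (hB : B ∈ OmegaA a Z) :
    treeVec T k B ∈ johnsonS Z (repRoot T k) := by
  have hs := treeV_isString T a k hk Z B hB
  rw [mem_johnsonS_iff]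
  constructor
  · intro C hC
    rw [treeVec]
    split_ifs with h
    · exact hs.supp C fun h' => hC ⟨h', h⟩
    · rfl
  · intro C hC hcard
    have h1 := hs.lower C hC
    rw [hs.eq_zero_of_card_lt C (by omega), mul_zero] at h1
    rw [← h1]
    refine Finset.sum_congr rfl fun x hx => ?_
    rw [treeVec, if_pos]
    rw [Finset.card_insert_of_notMem (Finset.mem_sdiff.1 hx).2, hcard]

theorem treeVec_conj (B : Leaf T → Finset α) (C : Finset α) :
    (starRingEnd ℂ) (treeVec T k B C) = treeVec T k B C := by
  rw [treeVec]
  split_ifs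
  · exact treeV_conj T k B C
  · exact map_zero _

theorem permRep_treeVec (g : Equiv.Perm α) (B : Leaf T → Finset α) :
    permRep (Finset α) g (treeVec T k B) = treeVec T k (g • B) := by
  funext C
  rw [permRep_apply, treeVec, treeVec, Finset.card_smul_finset, ← treeV_smul T k g,
    smul_inv_smul]

theorem treeT_permRep {g : Equiv.Perm α} (hg : g ∈ symOn Z) (u : Finset α → ℂ) :
    treeT T a k Z (permRep (Finset α) g u) =
      permRep (Leaf T → Finset α) g (treeT T a k Z u) := by
  classical
  funext B
  rw [permRep_apply]
  have hB : g⁻¹ • B ∈ OmegaA a Z ↔ B ∈ OmegaA a Z := by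
    conv_lhs => rw [← smul_eq_of_mem_symOn (inv_mem_symOn hg)]
    exact smul_mem_OmegaA g⁻¹
  change (if _ then _ else _) = if _ then _ else _
  simp only [hB]
  rw [← herm_permRep g u, permRep_treeVec, smul_inv_smul]

theorem permRep_treePsi {g : Equiv.Perm α} (hg : g ∈ symOn Z) (Y : Finset α) :
    permRep (Leaf T → Finset α) g (treePsi T a k Z Y) = treePsi T a k Z (g • Y) := by
  funext B
  rw [permRep_apply]
  have hB : g⁻¹ • B ∈ OmegaA a Z ↔ B ∈ OmegaA a Z := by
    conv_lhs => rw [← smul_eq_of_mem_symOn (inv_mem_symOn hg)]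
    exact smul_mem_OmegaA g⁻¹
  have hV : treeV T k (g⁻¹ • B) Y = treeV T k B (g • Y) := by
    rw [← treeV_smul T k g, smul_inv_smul]
  by_cases h : B ∈ OmegaA a Z
  · rw [treePsi_of_mem k Y (hB.2 h), treePsi_of_mem k _ h, hV]
  · rw [treePsi, treePsi, if_neg (mt hB.1 h), if_neg h]

/-- Pairing with the kernel evaluates at `Y`; the conjugation has no effect because `treeV` is real.
-/
theorem treeT_kernelS (hk : IsRepLabeling T a k) {Y : Finset α} (hY : Y.card = repRoot T k) :
    treeT T a k Z (kernelS Z (repRoot T k) Y) = treePsi T a k Z Y := by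
  classical
  funext B
  change (if _ then _ else _) = if _ then _ else _
  split_ifs with hB
  · rw [← herm_conj, herm_kernelS (treeVec_mem hk hB), treeVec_conj, treeVec, if_pos hY]
  · rfl

theorem exists_mem_OmegaA (T : BTree) (a : Leaf T → ℕ) {Z : Finset α} (hZ : Z.card = total a) :
    ∃ B, B ∈ OmegaA a Z := by
  induction T generalizing Z with
  | leaf => exact ⟨fun _ => Z, mem_OmegaA_leaf.2 ⟨hZ.trans (total_leaf a), rfl⟩⟩
  | node l r ihl ihr =>
    rw [total_node] at hZ
    obtain ⟨F, hF, hFc⟩ := Finset.exists_subset_card_eq (show total (leafL a) ≤ Z.card by omega)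
    obtain ⟨B', hB'⟩ := ihl (leafL a) hFc
    obtain ⟨B'', hB''⟩ := ihr (leafR a) (Z := Z \ F)
      (by rw [Finset.card_sdiff_of_subset hF]; omega)
    exact ⟨Sum.elim B' B'', ((mem_OmegaA_node_iff (B := Sum.elim B' B'') hF).2 ⟨hB', hB''⟩).1⟩

theorem exists_treeV_ne_zero (hk : IsRepLabeling T a k) (hZ : Z.card = total a) {X : Finset α}
    (hX : X ⊆ Z) (h1 : repRoot T k ≤ X.card) (h2 : X.card + repRoot T k ≤ Z.card) :
    ∃ B ∈ OmegaA a Z, treeV T k B X ≠ 0 := by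
  obtain ⟨B, hB⟩ := exists_mem_OmegaA T a hZ
  have hs := treeV_isString T a k hk Z B hB
  obtain ⟨C, hC, hC0⟩ := hs.exists_ne_zero (treeV_exists_ne_zero T a k hk Z B hB) X.card h1 h2
  have hCZ : C ⊆ Z := by
    by_contra h; exact hC0 (hs.supp C h)
  obtain ⟨g, hg, rfl⟩ := exists_mem_symOn_smul_eq hCZ hX hC
  refine ⟨g • B, ?_, by rwa [treeV_smul]⟩
  rw [← smul_eq_of_mem_symOn hg]
  exact (smul_mem_OmegaA g).2 hB

/-- The kernel of `treeT` is invariant, so if it met `S^{n-k,k}` it would contain it, including the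
vector `treeVec T k B`, whose pairing with itself is nonzero. -/
theorem eq_zero_of_treeT_eq_zero (hk : IsRepLabeling T a k) (hZ : Z.card = total a)
    {u : Finset α → ℂ} (hu : u ∈ johnsonS Z (repRoot T k)) (h : treeT T a k Z u = 0) : u = 0 := by
  classical
  by_contra hu0
  have hle := johnsonS_le_of_invariant (W := LinearMap.ker (treeT T a k Z)) ?_ hu h hu0
  · obtain ⟨B, hB⟩ := exists_mem_OmegaA T a hZ
    have h1 : treeT T a k Z (treeVec T k B) = 0 := hle (treeVec_mem hk hB)
    have h2 := congrFun h1 B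
    change (if _ then _ else _) = (0 : ℂ) at h2
    rw [if_pos hB] at h2
    have h3 := eq_zero_of_herm_self h2
    obtain ⟨X, hX, hX0⟩ := treeV_exists_ne_zero T a k hk Z B hB
    have h4 := congrFun h3 X
    rw [treeVec, if_pos hX] at h4
    exact hX0 h4
  · intro g hg f hf
    rw [LinearMap.mem_ker] at hf ⊢
    rw [treeT_permRep hg, hf, map_zero]

theorem treeR_isCopy (hk : IsRepLabeling T a k) (hZ : Z.card = total a) :
    IsCopy Z (repRoot T k) (treeR T a k Z) := by
  let L := (treeT T a k Z).domRestrict (johnsonS Z (repRoot T k))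
  have hL : Function.Injective L := by
    rw [← LinearMap.ker_eq_bot, LinearMap.ker_eq_bot']
    intro u hu
    exact Subtype.ext (eq_zero_of_treeT_eq_zero hk hZ u.2 hu)
  have hr : LinearMap.range L = treeR T a k Z := LinearMap.range_domRestrict _ _
  refine ⟨(LinearEquiv.ofInjective L hL).trans (LinearEquiv.ofEq _ _ hr), fun g hg f => ?_⟩
  exact treeT_permRep hg f

/-- For `|Y| = k` this is the image of a kernel. For larger `Y` the raising relation writes a
nonzero multiple of the function as a sum over the sets `Y` minus a point. -/
theorem treePsi_mem_treeR (hk : IsRepLabeling T a k) {Y : Finset α} (hY : Y ⊆ Z) :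
    treePsi T a k Z Y ∈ treeR T a k Z := by
  rcases lt_or_ge Y.card (repRoot T k) with hlt | hge
  · have : treePsi T a k Z Y = 0 := by
      funext B
      rw [treePsi]
      split_ifs with hB
      · exact (treeV_isString T a k hk Z B hB).eq_zero_of_card_lt Y hlt
      · rfl
    rw [this]
    exact Submodule.zero_mem _
  · obtain ⟨d, hn⟩ := Nat.exists_eq_add_of_le hge
    clear hge
    induction d generalizing Y with
    | zero => exact ⟨kernelS Z (repRoot T k) Y, kernelS_mem _ _ _, treeT_kernelS hk hn⟩
    | succ d ih =>
      have hsum : ∑ x ∈ Y, treePsi T a k Z (Y.erase x) ∈ treeR T a k Z :=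
        Submodule.sum_mem _ fun x hx => ih ((Finset.erase_subset x Y).trans hY)
          (by rw [Finset.card_erase_of_mem hx, hn]; rfl)
      have heq : ∑ x ∈ Y, treePsi T a k Z (Y.erase x) =
          ((Y.card : ℂ) - repRoot T k) • treePsi T a k Z Y := by
        funext B
        rw [Finset.sum_apply, Pi.smul_apply, smul_eq_mul]
        simp only [treePsi]
        split_ifs with hB
        · exact (treeV_isString T a k hk Z B hB).raise Y hY
        · simp
      have hne : ((Y.card : ℂ) - repRoot T k) ≠ 0 := by
        rw [sub_ne_zero]; exact_mod_cast (by omega : Y.card ≠ repRoot T k)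
      rw [heq] at hsum
      exact (Submodule.smul_mem_iff _ hne).1 hsum

theorem swapInv_of_treeT {X : Finset α} (hk : IsRepLabeling T a k) (hZ : Z.card = total a)
    (hX : X ⊆ Z) {u : Finset α → ℂ} (hu : u ∈ johnsonS Z (repRoot T k))
    (h : SwapInv X (treeT T a k Z u)) : SwapInv X u := by
  refine swapInv_of_permRep fun x hx y hy => ?_
  have hg := swap_mem_symOn (hX hx) (hX hy)
  rw [← sub_eq_zero]
  refine eq_zero_of_treeT_eq_zero hk hZ
    (Submodule.sub_mem _ (permRep_mem_johnsonS Z _ hg hu) hu) ?_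
  rw [map_sub, treeT_permRep hg, sub_eq_zero]
  funext B
  rw [permRep_apply, Equiv.swap_inv]
  exact h x hx y hy B

/-- The question is pulled back to `S^{n-k,k}` by injectivity, where invariants are unique up to
scalars. If `X` or its complement has fewer than `k` points there are none but zero; otherwise the
function `Ψ` of `X` is a nonzero one. -/
theorem exists_eq_smul_treePsi (hk : IsRepLabeling T a k) (hZ : Z.card = total a) {X : Finset α}
    (hX : X ⊆ Z) {f : (Leaf T → Finset α) → ℂ} (hf : f ∈ treeR T a k Z) (h1 : SwapInv X f)
    (h2 : SwapInv (Z \ X) f) : ∃ c : ℂ, f = c • treePsi T a k Z X := by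
  obtain ⟨u, hu, rfl⟩ := hf
  have hu1 := swapInv_of_treeT hk hZ hX hu h1
  have hu2 := swapInv_of_treeT hk hZ Finset.sdiff_subset hu h2
  rcases lt_or_ge X.card (repRoot T k) with hlt | hge
  · have h0 : u = 0 := eq_zero_of_vanish_subsets (X := X) hu hu2 fun C hC hCk => by
      have := Finset.card_le_card hC
      omega
    exact ⟨0, by rw [h0, map_zero, zero_smul]⟩
  rcases lt_or_ge (Z \ X).card (repRoot T k) with hlt' | hge'
  · have h0 : u = 0 := eq_zero_of_vanish_subsets (X := Z \ X) hu
      (by rwa [Finset.sdiff_sdiff_eq_self hX]) fun C hC hCk => by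
      have := Finset.card_le_card hC
      omega
    exact ⟨0, by rw [h0, map_zero, zero_smul]⟩
  have hXc := Finset.card_sdiff_of_subset hX
  have hXl := Finset.card_le_card hX
  obtain ⟨B, hB, hB0⟩ := exists_treeV_ne_zero hk hZ hX hge (by omega)
  obtain ⟨v, hv, hvX⟩ := treePsi_mem_treeR (a := a) hk hX
  have hv0 : v ≠ 0 := by
    rintro rfl
    rw [map_zero] at hvX
    have := congrFun hvX B
    rw [treePsi_of_mem k X hB] at this
    exact hB0 this.symm
  have hinv : ∀ x y, x ∈ Z → y ∈ Z → (x ∈ X ↔ y ∈ X) → ∀ B,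
      treePsi T a k Z X (Equiv.swap x y • B) = treePsi T a k Z X B := by
    intro x y hx hy hxy B
    have := congrFun (permRep_treePsi (T := T) (a := a) (k := k) (swap_mem_symOn hx hy) X) B
    rw [permRep_apply, Equiv.swap_inv, swap_smul_eq_self hxy] at this
    exact this
  obtain ⟨c, hc⟩ := exists_smul_eq_of_swapInv hu hv hv0 hu1 hu2
    (swapInv_of_treeT hk hZ hX hv (by
      rw [hvX]
      exact fun x hx y hy => hinv x y (hX hx) (hX hy) (by tauto)))
    (swapInv_of_treeT hk hZ Finset.sdiff_subset hv (by
      rw [hvX]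
      intro x hx y hy
      rw [Finset.mem_sdiff] at hx hy
      exact hinv x y hx.1 hy.1 (by tauto)))
  exact ⟨c, by rw [hc, map_smul, hvX]⟩

end TreeOperator

/-! ### Multiplicity one in the induced representation -/

section Induced

variable {α : Type} [Fintype α] [DecidableEq α]

set_option linter.unusedSectionVars false

variable {l r : BTree} {a : Leaf (.node l r) → ℕ} {k : Internal (.node l r) → ℕ} {Z : Finset α}

/-- The ordered partition with given restrictions to the subtrees. -/
def joinLeaf (B : Leaf l → Finset α) (C : Leaf r → Finset α) : Leaf (.node l r) → Finset α :=
  Sum.elim B C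

theorem joinLeaf_eta (B : Leaf (.node l r) → Finset α) : joinLeaf (leafL B) (leafR B) = B := by
  funext s
  rcases s with s | s <;> rfl

theorem smul_joinLeaf (g : Equiv.Perm α) (B : Leaf l → Finset α) (C : Leaf r → Finset α) :
    g • joinLeaf B C = joinLeaf (g • B) (g • C) := by
  funext s
  rcases s with s | s <;> rfl

theorem smul_eq_self_of_fixes {T : BTree} {g : Equiv.Perm α} {B : Leaf T → Finset α}
    (h : ∀ x ∈ blocks B, g x = x) : g • B = B := by
  funext s
  have h1 : ∀ x ∈ B s, g x = x := fun x hx => h x (mem_blocks.2 ⟨s, hx⟩)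
  apply Finset.eq_of_subset_of_card_le
  · intro y hy
    obtain ⟨x, hx, rfl⟩ := Finset.mem_smul_finset.1 hy
    rw [Equiv.Perm.smul_def, h1 x hx]
    exact hx
  · rw [Pi.smul_apply, Finset.card_smul_finset]

/-- The induced representation in which the constituent of the root is found. -/
abbrev treeInduced (l r : BTree) (a : Leaf (.node l r) → ℕ) (k : Internal (.node l r) → ℕ)
    (Z : Finset α) : Submodule ℂ ((Leaf (.node l r) → Finset α) → ℂ) :=
  induced (total (leafL a)) (treeR l (leafL a) (intL k)) (treeR r (leafR a) (intR k)) Z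

theorem treeV_node_apply {F : Finset α} (hF : F ⊆ Z) {B : Leaf l → Finset α}
    {C : Leaf r → Finset α} (hB : B ∈ OmegaA (leafL a) F) (hC : C ∈ OmegaA (leafR a) (Z \ F))
    (Y : Finset α) (hY : Y ⊆ Z) :
    treeV (.node l r) k (joinLeaf B C) Y =
      rootCoeff a k Y.card (Y ∩ (Z \ F)).card * treeV l (intL k) B (Y ∩ F) *
        treeV r (intR k) C (Y ∩ (Z \ F)) := by
  change stringNode _ _ _ (blocks B) (blocks C) (treeV l (intL k) B) (treeV r (intR k) C) Y = _
  rw [stringNode, blocks_eq hB, blocks_eq hC, Finset.union_sdiff_of_subset hF, if_pos hY,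
    card_of_mem_OmegaA hB, card_of_mem_OmegaA hC]
  rfl

theorem treePsi_mem_treeInduced (hk : IsRepLabeling (.node l r) a k) {Y : Finset α} (hY : Y ⊆ Z) :
    treePsi (.node l r) a k Z Y ∈ treeInduced l r a k Z := by
  obtain ⟨_, _, _, _, _, hkl, hkr⟩ := hk
  have : treePsi (.node l r) a k Z Y = ∑ F ∈ Z.powersetCard (total (leafL a)),
      rootCoeff a k Y.card (Y ∩ (Z \ F)).card •
        tens (treePsi l (leafL a) (intL k) F (Y ∩ F))
          (treePsi r (leafR a) (intR k) (Z \ F) (Y ∩ (Z \ F))) := by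
    funext B
    rw [Finset.sum_apply]
    simp only [Pi.smul_apply, tens, smul_eq_mul]
    by_cases hB : B ∈ OmegaA a Z
    · obtain ⟨h1, h2, h3⟩ := mem_OmegaA_node.1 hB
      rw [treePsi_of_mem k Y hB, Finset.sum_eq_single (blocks (leafL B))]
      · rw [treePsi_of_mem _ _ h2, treePsi_of_mem _ _ h3, ← mul_assoc]
        conv_lhs => rw [← joinLeaf_eta B]
        exact treeV_node_apply h1 h2 h3 Y hY
      · intro F _ hF
        rw [treePsi, if_neg fun hh => hF (blocks_eq hh).symm]
        simp
      · intro h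
        exact (h (Finset.mem_powersetCard.2 ⟨h1, card_of_mem_OmegaA h2⟩)).elim
    · rw [treePsi, if_neg hB]
      symm
      refine Finset.sum_eq_zero fun F hF => ?_
      by_cases h2 : leafL B ∈ OmegaA (leafL a) F
      · by_cases h3 : leafR B ∈ OmegaA (leafR a) (Z \ F)
        · exact (hB ((mem_OmegaA_node_iff (Finset.mem_powersetCard.1 hF).1).2 ⟨h2, h3⟩).1).elim
        · rw [treePsi_of_notMem _ _ h3, mul_zero, mul_zero]
      · rw [treePsi_of_notMem _ _ h2, zero_mul, mul_zero]
  rw [this]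
  refine Submodule.sum_mem _ fun F hF => Submodule.smul_mem _ _ ?_
  refine Submodule.mem_iSup_of_mem F (Submodule.mem_iSup_of_mem hF (Submodule.subset_span ?_))
  exact ⟨_, treePsi_mem_treeR hkl Finset.inter_subset_right, _,
    treePsi_mem_treeR hkr Finset.inter_subset_right, rfl⟩

theorem treeT_eq_sum {T : BTree} {a : Leaf T → ℕ} {k : Internal T → ℕ}
    (hk : IsRepLabeling T a k) {u : Finset α → ℂ} (hu : u ∈ johnsonS Z (repRoot T k)) :
    treeT T a k Z u = ∑ Y ∈ Z.powersetCard (repRoot T k), u Y • treePsi T a k Z Y := by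
  conv_lhs => rw [← sum_smul_kernelS hu, map_sum]
  symm
  rw [← Finset.sum_subset (Finset.subset_univ (Z.powersetCard (repRoot T k)))]
  · refine Finset.sum_congr rfl fun Y hY => ?_
    rw [map_smul, treeT_kernelS hk (Finset.mem_powersetCard.1 hY).2]
  · intro Y _ hY
    rw [kernelS_eq_zero fun h => hY (Finset.mem_powersetCard.2 h), smul_zero, map_zero]

theorem treeR_le_treeInduced (hk : IsRepLabeling (.node l r) a k) :
    treeR (.node l r) a k Z ≤ treeInduced l r a k Z := by
  rintro _ ⟨u, hu, rfl⟩
  rw [treeT_eq_sum hk hu]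
  exact Submodule.sum_mem _ fun Y hY => Submodule.smul_mem _ _
    (treePsi_mem_treeInduced hk (Finset.mem_powersetCard.1 hY).1)

theorem treeInduced_le_moduleM : treeInduced l r a k Z ≤ moduleM a Z := by
  refine iSup₂_le fun F hF => Submodule.span_le.2 ?_
  rintro _ ⟨f, hf, g, hg, rfl⟩ B hB
  rw [tens]
  by_cases h2 : leafL B ∈ OmegaA (leafL a) F
  · by_cases h3 : leafR B ∈ OmegaA (leafR a) (Z \ F)
    · exact (hB ((mem_OmegaA_node_iff (Finset.mem_powersetCard.1 hF).1).2 ⟨h2, h3⟩).1).elim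
    · rw [treeR_le_moduleM hg _ h3, mul_zero]
  · rw [treeR_le_moduleM hf _ h2, zero_mul]

open Classical in
/-- Restriction to the partitions of `F`, the right part being fixed. -/
def restrictL (a : Leaf (.node l r) → ℕ) (F : Finset α) (C : Leaf r → Finset α) :
    ((Leaf (.node l r) → Finset α) → ℂ) →ₗ[ℂ] ((Leaf l → Finset α) → ℂ) where
  toFun h B := if B ∈ OmegaA (leafL a) F then h (joinLeaf B C) else 0
  map_add' f g := by
    funext B
    simp only [Pi.add_apply]
    split_ifs <;> simp
  map_smul' c f := by
    funext B
    simp only [Pi.smul_apply, smul_eq_mul, RingHom.id_apply]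
    split_ifs <;> simp

open Classical in
/-- Restriction to the partitions of `G`, the left part being fixed. -/
def restrictR (a : Leaf (.node l r) → ℕ) (G : Finset α) (B : Leaf l → Finset α) :
    ((Leaf (.node l r) → Finset α) → ℂ) →ₗ[ℂ] ((Leaf r → Finset α) → ℂ) where
  toFun h C := if C ∈ OmegaA (leafR a) G then h (joinLeaf B C) else 0
  map_add' f g := by
    funext B
    simp only [Pi.add_apply]
    split_ifs <;> simp
  map_smul' c f := by
    funext B
    simp only [Pi.smul_apply, smul_eq_mul, RingHom.id_apply]
    split_ifs <;> simp

theorem restrictL_apply {F : Finset α} {C : Leaf r → Finset α} {B : Leaf l → Finset α}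
    (hB : B ∈ OmegaA (leafL a) F) (h : (Leaf (.node l r) → Finset α) → ℂ) :
    restrictL a F C h B = h (joinLeaf B C) := if_pos hB

theorem restrictR_apply {G : Finset α} {B : Leaf l → Finset α} {C : Leaf r → Finset α}
    (hC : C ∈ OmegaA (leafR a) G) (h : (Leaf (.node l r) → Finset α) → ℂ) :
    restrictR a G B h C = h (joinLeaf B C) := if_pos hC

/-- Fixing one tensor factor of a pure tensor leaves a multiple of the other; summands with a
different `F` restrict to zero. -/
theorem restrictL_mem {F : Finset α} {C : Leaf r → Finset α}
    {h : (Leaf (.node l r) → Finset α) → ℂ} (hh : h ∈ treeInduced l r a k Z) :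
    restrictL a F C h ∈ treeR l (leafL a) (intL k) F := by
  suffices H : treeInduced l r a k Z ≤
      (treeR l (leafL a) (intL k) F).comap (restrictL a F C) from H hh
  refine iSup₂_le fun F' _ => Submodule.span_le.2 ?_
  rintro _ ⟨f, hf, g, hg, rfl⟩
  change restrictL a F C (tens f g) ∈ treeR l (leafL a) (intL k) F
  by_cases hF : F' = F
  · subst hF
    have : restrictL a F' C (tens f g) = g C • f := by
      funext B
      by_cases hB : B ∈ OmegaA (leafL a) F'
      · rw [restrictL_apply hB]
        exact mul_comm _ _
      · rw [Pi.smul_apply, treeR_le_moduleM hf B hB, smul_zero]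
        exact if_neg hB
    rw [this]
    exact Submodule.smul_mem _ _ hf
  · have : restrictL a F C (tens f g) = 0 := by
      funext B
      by_cases hB : B ∈ OmegaA (leafL a) F
      · rw [restrictL_apply hB]
        change f B * g C = 0
        rw [treeR_le_moduleM hf B fun h => hF ((blocks_eq h).symm.trans (blocks_eq hB)), zero_mul]
      · exact if_neg hB
    rw [this]
    exact Submodule.zero_mem _

theorem restrictR_mem {F : Finset α} {B : Leaf l → Finset α}
    (hB : B ∈ OmegaA (leafL a) F) {h : (Leaf (.node l r) → Finset α) → ℂ}
    (hh : h ∈ treeInduced l r a k Z) :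
    restrictR a (Z \ F) B h ∈ treeR r (leafR a) (intR k) (Z \ F) := by
  suffices H : treeInduced l r a k Z ≤
      (treeR r (leafR a) (intR k) (Z \ F)).comap (restrictR a (Z \ F) B) from H hh
  refine iSup₂_le fun F' _ => Submodule.span_le.2 ?_
  rintro _ ⟨f, hf, g, hg, rfl⟩
  change restrictR a (Z \ F) B (tens f g) ∈ treeR r (leafR a) (intR k) (Z \ F)
  by_cases hF : F' = F
  · subst hF
    have : restrictR a (Z \ F') B (tens f g) = f B • g := by
      funext C
      by_cases hC : C ∈ OmegaA (leafR a) (Z \ F')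
      · rw [restrictR_apply hC]
        rfl
      · rw [Pi.smul_apply, treeR_le_moduleM hg C hC, smul_zero]
        exact if_neg hC
    rw [this]
    exact Submodule.smul_mem _ _ hg
  · have : restrictR a (Z \ F) B (tens f g) = 0 := by
      funext C
      by_cases hC : C ∈ OmegaA (leafR a) (Z \ F)
      · rw [restrictR_apply hC]
        change f B * g C = 0
        rw [treeR_le_moduleM hf B fun h => hF ((blocks_eq h).symm.trans (blocks_eq hB)), zero_mul]
      · exact if_neg hC
    rw [this]
    exact Submodule.zero_mem _

theorem smul_mem_of_swap {T : BTree} {b : Leaf T → ℕ} {F : Finset α} {x y : α} (hx : x ∈ F)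
    (hy : y ∈ F) (B : Leaf T → Finset α) :
    Equiv.swap x y • B ∈ OmegaA b F ↔ B ∈ OmegaA b F := by
  conv_lhs => rw [← smul_eq_of_mem_symOn (swap_mem_symOn hx hy)]
  exact smul_mem_OmegaA _

theorem swap_smul_eq_self_of_mem_OmegaA {T : BTree} {b : Leaf T → ℕ} {F G : Finset α}
    (hFG : Disjoint F G) {x y : α} (hx : x ∈ F) (hy : y ∈ F) {B : Leaf T → Finset α}
    (hB : B ∈ OmegaA b G) : Equiv.swap x y • B = B := by
  refine smul_eq_self_of_fixes fun z hz => ?_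
  rw [blocks_eq hB] at hz
  exact Equiv.swap_apply_of_ne_of_ne (fun h => Finset.disjoint_left.1 hFG hx (h ▸ hz))
    (fun h => Finset.disjoint_left.1 hFG hy (h ▸ hz))

/-- A vector of the induced representation that is invariant under the stabilizer of `Y` is, on the
partitions that refine `(F, Z \ F)`, a multiple of the tensor product of the functions `Ψ`. -/
theorem exists_eq_mul_treeV (hk : IsRepLabeling (.node l r) a k) {F : Finset α} (hF : F ⊆ Z)
    (hFc : F.card = total (leafL a)) (hGc : (Z \ F).card = total (leafR a))
    {Y : Finset α} {h : (Leaf (.node l r) → Finset α) → ℂ} (hh : h ∈ treeInduced l r a k Z)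
    (hinv : ∀ x ∈ Z, ∀ y ∈ Z, (x ∈ Y ↔ y ∈ Y) → ∀ B, h (Equiv.swap x y • B) = h B) :
    ∃ c : ℂ, ∀ B ∈ OmegaA (leafL a) F, ∀ C ∈ OmegaA (leafR a) (Z \ F),
      h (joinLeaf B C) = c * (treeV l (intL k) B (Y ∩ F) * treeV r (intR k) C (Y ∩ (Z \ F))) := by
  obtain ⟨_, _, _, _, _, hkl, hkr⟩ := hk
  have hdis : Disjoint F (Z \ F) := Finset.disjoint_sdiff
  have swL : ∀ C ∈ OmegaA (leafR a) (Z \ F), ∀ x ∈ F, ∀ y ∈ F, (x ∈ Y ↔ y ∈ Y) → ∀ B,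
      restrictL a F C h (Equiv.swap x y • B) = restrictL a F C h B := by
    intro C hC x hx y hy hxy B
    by_cases hB : B ∈ OmegaA (leafL a) F
    · rw [restrictL_apply hB, restrictL_apply ((smul_mem_of_swap hx hy B).2 hB),
        ← hinv x (hF hx) y (hF hy) hxy (joinLeaf B C), smul_joinLeaf,
        swap_smul_eq_self_of_mem_OmegaA hdis hx hy hC]
    · exact (if_neg (mt (smul_mem_of_swap hx hy B).1 hB)).trans (if_neg hB).symm
  have swR : ∀ B ∈ OmegaA (leafL a) F, ∀ x ∈ Z \ F, ∀ y ∈ Z \ F, (x ∈ Y ↔ y ∈ Y) → ∀ C,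
      restrictR a (Z \ F) B h (Equiv.swap x y • C) = restrictR a (Z \ F) B h C := by
    intro B hB x hx y hy hxy C
    by_cases hC : C ∈ OmegaA (leafR a) (Z \ F)
    · rw [restrictR_apply hC, restrictR_apply ((smul_mem_of_swap hx hy C).2 hC),
        ← hinv x (Finset.sdiff_subset hx) y (Finset.sdiff_subset hy) hxy (joinLeaf B C),
        smul_joinLeaf, swap_smul_eq_self_of_mem_OmegaA hdis.symm hx hy hB]
    · exact (if_neg (mt (smul_mem_of_swap hx hy C).1 hC)).trans (if_neg hC).symm
  have hL : ∀ C ∈ OmegaA (leafR a) (Z \ F), ∃ c : ℂ,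
      restrictL a F C h = c • treePsi l (leafL a) (intL k) F (Y ∩ F) := by
    intro C hC
    refine exists_eq_smul_treePsi hkl hFc Finset.inter_subset_right (restrictL_mem hh) ?_ ?_
    · intro x hx y hy
      rw [Finset.mem_inter] at hx hy
      exact swL C hC x hx.2 y hy.2 (by tauto)
    · intro x hx y hy
      rw [Finset.mem_sdiff, Finset.mem_inter] at hx hy
      exact swL C hC x hx.1 y hy.1 (by tauto)
  have hR : ∀ B ∈ OmegaA (leafL a) F, ∃ c : ℂ,
      restrictR a (Z \ F) B h = c • treePsi r (leafR a) (intR k) (Z \ F) (Y ∩ (Z \ F)) := by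
    intro B hB
    refine exists_eq_smul_treePsi hkr hGc Finset.inter_subset_right (restrictR_mem hB hh) ?_ ?_
    · intro x hx y hy
      rw [Finset.mem_inter] at hx hy
      exact swR B hB x hx.2 y hy.2 (by tauto)
    · intro x hx y hy
      rw [Finset.mem_sdiff, Finset.mem_inter] at hx hy
      exact swR B hB x hx.1 y hy.1 (by tauto)
  -- All slices in either variable are multiples of one function. Comparison with the slice through
  -- a point `B₀` where the left function is nonzero makes the scalar independent of `C`.
  by_cases h0 : ∃ B ∈ OmegaA (leafL a) F, treeV l (intL k) B (Y ∩ F) ≠ 0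
  · obtain ⟨B₀, hB₀, hV₀⟩ := h0
    obtain ⟨d, hd⟩ := hR B₀ hB₀
    refine ⟨d / treeV l (intL k) B₀ (Y ∩ F), fun B hB C hC => ?_⟩
    obtain ⟨c, hc⟩ := hL C hC
    have h1 := congrFun hc B
    have h2 := congrFun hc B₀
    have h3 := congrFun hd C
    rw [restrictL_apply hB, Pi.smul_apply, treePsi_of_mem _ _ hB, smul_eq_mul] at h1
    rw [restrictL_apply hB₀, Pi.smul_apply, treePsi_of_mem _ _ hB₀, smul_eq_mul] at h2
    rw [restrictR_apply hC, Pi.smul_apply, treePsi_of_mem _ _ hC, smul_eq_mul, h2] at h3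
    rw [h1]
    field_simp
    linear_combination treeV l (intL k) B (Y ∩ F) * h3
  · push Not at h0
    refine ⟨0, fun B hB C hC => ?_⟩
    obtain ⟨c, hc⟩ := hL C hC
    have h1 := congrFun hc B
    rw [restrictL_apply hB, Pi.smul_apply, treePsi_of_mem _ _ hB, h0 B hB, smul_zero] at h1
    rw [h1, zero_mul]

end Induced

/-! ### Proportionality of equivariant maps to the induced representation -/

section Uniqueness

variable {α : Type} [Fintype α] [DecidableEq α]

set_option linter.unusedSectionVars false

variable {l r : BTree} {a : Leaf (.node l r) → ℕ} {k : Internal (.node l r) → ℕ} {Z : Finset α}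

/-- The images of the reproducing kernels of `S^{n-k,k}(Z)` under an equivariant linear map to the
induced representation. -/
structure IsKernelFamily (l r : BTree) (a : Leaf (.node l r) → ℕ) (k : Internal (.node l r) → ℕ)
    (Z : Finset α) (K : Finset α → (Leaf (.node l r) → Finset α) → ℂ) : Prop where
  mem : ∀ Y, K Y ∈ treeInduced l r a k Z
  smul : ∀ g ∈ symOn Z, ∀ Y B, K (g • Y) (g • B) = K Y B
  sum : ∀ Y, Y ⊆ Z → Y.card + 1 = atRoot k → ∑ x ∈ Z \ Y, K (insert x Y) = 0

theorem IsKernelFamily.exists_eq_mul {K : Finset α → (Leaf (.node l r) → Finset α) → ℂ}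
    (hK : IsKernelFamily l r a k Z K) (hk : IsRepLabeling (.node l r) a k) {F : Finset α}
    (hF : F ⊆ Z) (hFc : F.card = total (leafL a)) (hGc : (Z \ F).card = total (leafR a))
    (Y : Finset α) :
    ∃ c : ℂ, ∀ B ∈ OmegaA (leafL a) F, ∀ C ∈ OmegaA (leafR a) (Z \ F),
      K Y (joinLeaf B C) =
        c * (treeV l (intL k) B (Y ∩ F) * treeV r (intR k) C (Y ∩ (Z \ F))) := by
  refine exists_eq_mul_treeV hk hF hFc hGc (hK.mem Y) fun x hx y hy hxy B => ?_
  conv_lhs => rw [← swap_smul_eq_self (x := x) (y := y) hxy]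
  exact hK.smul _ (swap_mem_symOn hx hy) Y B

/-- `K Y` vanishes on all partitions that refine `(F, Z \ F)`. -/
def VanishesOn (a : Leaf (.node l r) → ℕ) (Z F : Finset α)
    (K : Finset α → (Leaf (.node l r) → Finset α) → ℂ) (Y : Finset α) : Prop :=
  ∀ B ∈ OmegaA (leafL a) F, ∀ C ∈ OmegaA (leafR a) (Z \ F), K Y (joinLeaf B C) = 0

theorem IsKernelFamily.vanishesOn_swap {K : Finset α → (Leaf (.node l r) → Finset α) → ℂ}
    (hK : IsKernelFamily l r a k Z K) {F : Finset α} {x y : α} (hx : x ∈ Z)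
    (hy : y ∈ Z) (hxy : x ∈ F ↔ y ∈ F) (Y : Finset α) :
    VanishesOn a Z F K (Equiv.swap x y • Y) = VanishesOn a Z F K Y := by
  have hg := swap_mem_symOn hx hy
  have hgF : Equiv.swap x y • F = F := swap_smul_eq_self hxy
  have hgG : Equiv.swap x y • (Z \ F) = Z \ F := by
    rw [Finset.smul_finset_sdiff, smul_eq_of_mem_symOn hg, hgF]
  have key : ∀ Y, VanishesOn a Z F K Y → VanishesOn a Z F K (Equiv.swap x y • Y) := by
    intro Y h B hB C hC
    rw [← hgF] at hB
    rw [← hgG] at hC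
    have h1 := hK.smul _ hg Y (Equiv.swap x y • joinLeaf B C)
    rw [smul_joinLeaf, smul_joinLeaf, ← mul_smul, ← mul_smul, Equiv.swap_mul_self, one_smul,
      one_smul] at h1
    rw [h1]
    refine h _ ?_ _ ?_
    · rwa [← smul_mem_OmegaA (Equiv.swap x y), ← mul_smul, Equiv.swap_mul_self, one_smul]
    · rwa [← smul_mem_OmegaA (Equiv.swap x y), ← mul_smul, Equiv.swap_mul_self, one_smul]
  refine propext ⟨fun h => ?_, key Y⟩
  have h2 := key _ h
  rwa [← mul_smul, Equiv.swap_mul_self, one_smul] at h2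

theorem card_eq_inter_add_inter_sdiff {Z F Y : Finset α} (hY : Y ⊆ Z) :
    Y.card = (Y ∩ F).card + (Y ∩ (Z \ F)).card := by
  rw [← Finset.card_inter_add_card_sdiff Y F]
  congr 2
  ext z
  simp only [Finset.mem_sdiff, Finset.mem_inter]
  exact ⟨fun h => ⟨h.1, hY h.1, h.2⟩, fun h => ⟨h.1, h.2.2⟩⟩

/-- Permutations that preserve `F` act transitively on the sets of given bidegree; `Y` is changed to
`Y'` first inside `F`, then outside. -/
theorem IsKernelFamily.vanishesOn_congr {K : Finset α → (Leaf (.node l r) → Finset α) → ℂ}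
    (hK : IsKernelFamily l r a k Z K) {F : Finset α} (hF : F ⊆ Z) {Y Y' : Finset α} (hY : Y ⊆ Z)
    (hY' : Y' ⊆ Z) (hcL : (Y ∩ F).card = (Y' ∩ F).card)
    (hcR : (Y ∩ (Z \ F)).card = (Y' ∩ (Z \ F)).card) (h : VanishesOn a Z F K Y) :
    VanishesOn a Z F K Y' := by
  have hdis : Disjoint F (Z \ F) := Finset.disjoint_sdiff
  have h1 : VanishesOn a Z F K Y = VanishesOn a Z F K ((Y' ∩ F) ∪ (Y ∩ (Z \ F))) := by
    refine SwapInv.eq_of_card_eq (X := F) (fun x hx y hy C =>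
      hK.vanishesOn_swap (hF hx) (hF hy) (by tauto) C) ?_ ?_
    · ext z
      simp only [Finset.mem_sdiff, Finset.mem_union, Finset.mem_inter]
      have := @hY z
      tauto
    · rw [Finset.card_union_of_disjoint
        (hdis.mono Finset.inter_subset_right Finset.inter_subset_right), ← hcL]
      exact card_eq_inter_add_inter_sdiff hY
  have h2 : VanishesOn a Z F K ((Y' ∩ F) ∪ (Y ∩ (Z \ F))) = VanishesOn a Z F K Y' := by
    refine SwapInv.eq_of_card_eq (X := Z \ F) (fun x hx y hy C => ?_) ?_ ?_
    · rw [Finset.mem_sdiff] at hx hy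
      exact hK.vanishesOn_swap hx.1 hy.1 (by tauto) C
    · ext z
      simp only [Finset.mem_sdiff, Finset.mem_union, Finset.mem_inter]
      have := @hY' z
      tauto
    · rw [Finset.card_union_of_disjoint
        (hdis.mono Finset.inter_subset_right Finset.inter_subset_right), hcR]
      exact (card_eq_inter_add_inter_sdiff hY').symm
  rw [← h2, ← h1]
  exact h

/-- Induction on `w = |Y ∩ (Z \ F)|`. For `w < j` the right string vanishes, and `w = j` is the
bidegree of `Y₁`. For `w > j` the kernel relation at `Y` minus a point of `Z \ F` involves only the
bidegrees of `w - 1` and `w`. -/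
theorem IsKernelFamily.vanishesOn_of_vanishesOn
    {K : Finset α → (Leaf (.node l r) → Finset α) → ℂ}
    (hK : IsKernelFamily l r a k Z K) (hk : IsRepLabeling (.node l r) a k) {F : Finset α}
    (hF : F ⊆ Z) (hFc : F.card = total (leafL a)) (hGc : (Z \ F).card = total (leafR a))
    {Y₁ : Finset α} (hY₁ : Y₁ ⊆ Z) (hY₁c : Y₁.card = atRoot k)
    (hY₁G : (Y₁ ∩ (Z \ F)).card = repRoot r (intR k)) (h₁ : VanishesOn a Z F K Y₁)
    (Y : Finset α) (hY : Y ⊆ Z) (hYc : Y.card = atRoot k) : VanishesOn a Z F K Y := by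
  have hkr : IsRepLabeling r (leafR a) (intR k) := hk.2.2.2.2.2.2
  have hc₁ := card_eq_inter_add_inter_sdiff (F := F) hY₁
  induction hw : (Y ∩ (Z \ F)).card using Nat.strong_induction_on generalizing Y with
  | _ w ih =>
    have hc := card_eq_inter_add_inter_sdiff (F := F) hY
    obtain ⟨c, hc'⟩ := hK.exists_eq_mul hk hF hFc hGc Y
    rcases lt_trichotomy w (repRoot r (intR k)) with hlt | heq | hgt
    · intro B hB C hC
      rw [hc' B hB C hC, (treeV_isString r _ _ hkr _ C hC).eq_zero_of_card_lt _ (by omega),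
        mul_zero, mul_zero]
    · exact hK.vanishesOn_congr hF hY₁ hY (by omega) (by omega) h₁
    · obtain ⟨y, hy⟩ := Finset.card_pos.1 (by omega : 0 < (Y ∩ (Z \ F)).card)
      obtain ⟨hyY, hyG⟩ := Finset.mem_inter.1 hy
      obtain ⟨hyZ, hyF⟩ := Finset.mem_sdiff.1 hyG
      have hY0F : (Y.erase y) ∩ F = Y ∩ F := by
        rw [Finset.erase_inter, Finset.erase_eq_of_notMem
          fun h => hyF (Finset.mem_inter.1 h).2]
      have hY0G : (Y.erase y) ∩ (Z \ F) = (Y ∩ (Z \ F)).erase y := Finset.erase_inter ..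
      have hY0c : ((Y.erase y) ∩ (Z \ F)).card = w - 1 := by
        rw [hY0G, Finset.card_erase_of_mem hy, hw]
      have hY0Z : Y.erase y ⊆ Z := (Finset.erase_subset _ _).trans hY
      -- The terms with `x ∈ F` vanish by induction. Those with `x ∉ F` are transforms of `K Y` by
      -- the transposition of `y` and `x`, which fixes `F`; they share the scalar `c`, and the
      -- lowering relation of the right string sums them.
      have hrel : ∀ B ∈ OmegaA (leafL a) F, ∀ C ∈ OmegaA (leafR a) (Z \ F),
          c * treeV l (intL k) B (Y ∩ F) * (((total (leafR a) : ℂ) - repRoot r (intR k) -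
            (w - 1 : ℕ)) * treeV r (intR k) C ((Y.erase y) ∩ (Z \ F))) = 0 := by
        intro B hB C hC
        have hYpos := Finset.card_pos.2 ⟨y, hyY⟩
        have hsum := congrFun (hK.sum (Y.erase y) hY0Z
          (by rw [Finset.card_erase_of_mem hyY]; omega)) (joinLeaf B C)
        rw [Finset.sum_apply] at hsum
        have hlow := (treeV_isString r _ _ hkr _ C hC).lower ((Y.erase y) ∩ (Z \ F))
          Finset.inter_subset_right
        rw [hGc, hY0c] at hlow
        rw [← hlow, Finset.mul_sum]
        refine Eq.trans ?_ hsum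
        have hsub : (Z \ F) \ (Y.erase y ∩ (Z \ F)) ⊆ Z \ Y.erase y := by
          intro z
          simp only [Finset.mem_sdiff, Finset.mem_inter]
          tauto
        rw [← Finset.sum_subset hsub]
        · refine Finset.sum_congr rfl fun x hx => ?_
          obtain ⟨hxG, hxY⟩ := Finset.mem_sdiff.1 hx
          have hxY0 : x ∉ Y.erase y := fun h => hxY (Finset.mem_inter.2 ⟨h, hxG⟩)
          obtain ⟨hxZ, hxF⟩ := Finset.mem_sdiff.1 hxG
          have hgY : Equiv.swap y x • Y = insert x (Y.erase y) := by
            by_cases hxy : x = y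
            · rw [hxy, Equiv.swap_self, Finset.insert_erase hyY]
              exact one_smul _ _
            · exact swap_smul_finset hyY fun h => hxY0 (Finset.mem_erase.2 ⟨hxy, h⟩)
          have hg := swap_mem_symOn hyZ hxZ
          have hgF : Equiv.swap y x • F = F := swap_smul_eq_self (by tauto)
          have hgG : Equiv.swap y x • (Z \ F) = Z \ F := by
            rw [Finset.smul_finset_sdiff, smul_eq_of_mem_symOn hg, hgF]
          have hgg : ∀ {T : BTree} (B : Leaf T → Finset α),
              Equiv.swap y x • (Equiv.swap y x • B) = B := fun B => by
            rw [← mul_smul, Equiv.swap_mul_self, one_smul]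
          have e1 : K (insert x (Y.erase y)) (joinLeaf B C) =
              K Y (joinLeaf (Equiv.swap y x • B) (Equiv.swap y x • C)) := by
            rw [← hgY, ← hK.smul _ hg Y, smul_joinLeaf, hgg, hgg]
          have eL : treeV l (intL k) (Equiv.swap y x • B) (Y ∩ F) =
              treeV l (intL k) B (Y ∩ F) := by
            rw [← treeV_smul l _ (Equiv.swap y x), hgg, Finset.smul_finset_inter, hgF, hgY,
              Finset.insert_inter_of_notMem hxF, hY0F]
          have eR : treeV r (intR k) (Equiv.swap y x • C) (Y ∩ (Z \ F)) =
              treeV r (intR k) C (insert x (Y.erase y ∩ (Z \ F))) := by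
            rw [← treeV_smul r _ (Equiv.swap y x), hgg, Finset.smul_finset_inter, hgG, hgY,
              Finset.insert_inter_of_mem hxG]
          rw [e1, hc' _ ((smul_mem_OmegaA (Equiv.swap y x)).1 (by rwa [hgg, hgF])) _
            ((smul_mem_OmegaA (Equiv.swap y x)).1 (by rwa [hgg, hgG])),
            eL, eR, mul_assoc]
        · intro x hx hxG
          obtain ⟨hxZ, hxY⟩ := Finset.mem_sdiff.1 hx
          have hxF : x ∈ F := by
            by_contra hxF
            exact hxG (Finset.mem_sdiff.2 ⟨Finset.mem_sdiff.2 ⟨hxZ, hxF⟩,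
              fun h => hxY (Finset.mem_inter.1 h).1⟩)
          refine ih (w - 1) (by omega) (insert x (Y.erase y)) (Finset.insert_subset hxZ hY0Z)
            ?_ ?_ B hB C hC
          · rw [Finset.card_insert_of_notMem hxY, Finset.card_erase_of_mem hyY]; omega
          · rw [Finset.insert_inter_of_notMem (fun h => (Finset.mem_sdiff.1 h).2 hxF), hY0c]
      intro B hB C hC
      rw [hc' B hB C hC]
      rcases lt_or_ge (total (leafR a)) (w + repRoot r (intR k)) with hbig | hsmall
      · rw [(treeV_isString r _ _ hkr _ C hC).eq_zero_of_lt_card _ (by omega), mul_zero, mul_zero]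
      -- Degree `w - 1` lies within the range of the right string, so some `C'` isolates the product
      -- of `c` and the left factor; the lowering scalar is at least `1` because `w + j ≤ q`.
      · obtain ⟨C', hC', hC0⟩ := exists_treeV_ne_zero hkr hGc
          (X := (Y.erase y) ∩ (Z \ F)) Finset.inter_subset_right (by omega) (by omega)
        have h1 := hrel B hB C' hC'
        have hne : (total (leafR a) : ℂ) - repRoot r (intR k) - (w - 1 : ℕ) ≠ 0 := by
          rw [sub_sub, sub_ne_zero]
          exact_mod_cast (by omega : total (leafR a) ≠ repRoot r (intR k) + (w - 1))
        have h2 := (mul_eq_zero.1 h1).resolve_right (mul_ne_zero hne hC0)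
        rw [← mul_assoc, h2, zero_mul]

/-- A kernel family that vanishes at one suitable point is zero: the relations among the kernels of
`S^{n-k,k}` determine its scalars on all bidegrees. -/
theorem IsKernelFamily.eq_zero {K : Finset α → (Leaf (.node l r) → Finset α) → ℂ}
    (hK : IsKernelFamily l r a k Z K) (hk : IsRepLabeling (.node l r) a k)
    (hZ : Z.card = total a) {F : Finset α} (hF : F ⊆ Z) (hFc : F.card = total (leafL a))
    {Y₁ : Finset α} (hY₁ : Y₁ ⊆ Z) (hY₁c : Y₁.card = atRoot k)
    (hY₁G : (Y₁ ∩ (Z \ F)).card = repRoot r (intR k))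
    {B₁ : Leaf l → Finset α} (hB₁ : B₁ ∈ OmegaA (leafL a) F)
    {C₁ : Leaf r → Finset α} (hC₁ : C₁ ∈ OmegaA (leafR a) (Z \ F))
    (hV : treeV l (intL k) B₁ (Y₁ ∩ F) ≠ 0) (hV' : treeV r (intR k) C₁ (Y₁ ∩ (Z \ F)) ≠ 0)
    (h₁ : K Y₁ (joinLeaf B₁ C₁) = 0)
    (Y : Finset α) (hY : Y ⊆ Z) (hYc : Y.card = atRoot k) : K Y = 0 := by
  have hGc : (Z \ F).card = total (leafR a) := by
    rw [Finset.card_sdiff_of_subset hF, hZ, total_node]; omega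
  have hvan : VanishesOn a Z F K Y₁ := by
    obtain ⟨c, hc⟩ := hK.exists_eq_mul hk hF hFc hGc Y₁
    rw [hc _ hB₁ _ hC₁] at h₁
    have hc0 := (mul_eq_zero.1 h₁).resolve_right (mul_ne_zero hV hV')
    intro B hB C hC
    rw [hc _ hB _ hC, hc0, zero_mul]
  have hall := hK.vanishesOn_of_vanishesOn hk hF hFc hGc hY₁ hY₁c hY₁G hvan
  funext B
  by_cases hB : B ∈ OmegaA a Z
  swap
  · exact treeInduced_le_moduleM (hK.mem Y) B hB
  obtain ⟨h1, h2, h3⟩ := mem_OmegaA_node.1 hB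
  -- Equivariance carries the left part of an arbitrary partition to the fixed `F`, at the cost of
  -- replacing `Y` by `g • Y`.
  obtain ⟨g, hg, hgF⟩ := exists_mem_symOn_smul_eq h1 hF ((card_of_mem_OmegaA h2).trans hFc.symm)
  rw [← hK.smul g hg, ← joinLeaf_eta B, smul_joinLeaf]
  refine hall (g • Y) ?_ ?_ _ ?_ _ ?_
  · rw [← smul_eq_of_mem_symOn hg]
    exact Finset.smul_finset_subset_smul_finset hY
  · rw [Finset.card_smul_finset, hYc]
  · rw [← hgF]; exact (smul_mem_OmegaA g).2 h2
  · have e : Z \ F = g • (Z \ blocks (leafL B)) := by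
      rw [Finset.smul_finset_sdiff, smul_eq_of_mem_symOn hg, hgF]
    rw [e]
    exact (smul_mem_OmegaA g).2 h3

/-- The embedding `L` of the copy and the operator `treeT` are shown to be proportional with nonzero
factors, so their images agree. -/
theorem eq_treeR_of_isCopy (hk : IsRepLabeling (.node l r) a k) (hZ : Z.card = total a)
    {U : Submodule ℂ ((Leaf (.node l r) → Finset α) → ℂ)} (hU : U ≤ treeInduced l r a k Z)
    (hcopy : IsCopy Z (atRoot k) U) : U = treeR (.node l r) a k Z := by
  obtain ⟨e, he⟩ := hcopy
  obtain ⟨hk1, hk2, hk3, hk4, hij, hkl, hkr⟩ := id hk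
  obtain ⟨B₁, hB₁⟩ := exists_mem_OmegaA (.node l r) a hZ
  obtain ⟨h1, h2, h3⟩ := mem_OmegaA_node.1 hB₁
  have hR := blocks_eq h3
  have hdis : Disjoint (blocks (leafL B₁)) (blocks (leafR B₁)) := hR ▸ Finset.disjoint_sdiff
  have hc2 := card_of_mem_OmegaA h2
  have hc3 := card_of_mem_OmegaA h3
  have h3' := h3
  rw [← hR] at h3'
  obtain ⟨Y₁, ⟨hY₁c, _, hY₁G⟩, hV, hV', hV₁⟩ := stringNode_ne_zero
    (κ := atRoot k - repRoot l (intL k) - repRoot r (intR k))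
    (treeV_isString l _ _ hkl _ _ h2) (treeV_isString r _ _ hkr _ _ h3') hdis
    (treeV_exists_ne_zero _ _ _ hkl _ _ h2) (treeV_exists_ne_zero _ _ _ hkr _ _ h3')
    (by rw [hc2]; omega) (by rw [hR, hc3]; omega)
  have hY₁c' : Y₁.card = atRoot k := by omega
  have hY₁Z : Y₁ ⊆ Z := by
    by_contra hs
    exact hV₁ ((treeV_isString _ _ _ hk _ _ hB₁).supp Y₁ hs)
  rw [hR] at hY₁G hV'
  change treeV (.node l r) k B₁ Y₁ ≠ 0 at hV₁
  let s : Finset α → johnsonS Z (atRoot k) := fun Y => ⟨kernelS Z _ Y, kernelS_mem _ _ _⟩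
  let L : johnsonS Z (atRoot k) →ₗ[ℂ] ((Leaf (.node l r) → Finset α) → ℂ) :=
    U.subtype ∘ₗ e.toLinearMap
  have hL : ∀ u, L u = (e u : (Leaf (.node l r) → Finset α) → ℂ) := fun u => rfl
  -- `c` and `d` are the values at `B₁` of the images of the kernel at `Y₁` under `treeT` and `L`;
  -- hence `M` vanishes at this point, which forces `M = 0`.
  let c := treeV (.node l r) k B₁ Y₁
  let d := L (s Y₁) B₁
  let M : johnsonS Z (atRoot k) →ₗ[ℂ] ((Leaf (.node l r) → Finset α) → ℂ) :=
    c • L - d • (treeT (.node l r) a k Z).domRestrict _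
  have hM : ∀ u, M u = c • L u - d • treeT (.node l r) a k Z u := fun u => rfl
  have hMW : ∀ u, M u ∈ treeInduced l r a k Z := by
    intro u
    rw [hM]
    exact Submodule.sub_mem _ (Submodule.smul_mem _ _ (hU (e u).2))
      (Submodule.smul_mem _ _ (treeR_le_treeInduced hk ⟨u, u.2, rfl⟩))
  have hMg : ∀ (g : Equiv.Perm α) (hg : g ∈ symOn Z) (u : johnsonS Z (atRoot k)),
      M ⟨permRep (Finset α) g u, permRep_mem_johnsonS Z _ hg u.2⟩ =
        permRep (Leaf (.node l r) → Finset α) g (M u) := by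
    intro g hg u
    rw [hM, hM, map_sub, map_smul, map_smul, hL, he g hg, treeT_permRep hg]
    rfl
  have hfam : IsKernelFamily l r a k Z fun Y => M (s Y) := by
    refine ⟨fun Y => hMW _, fun g hg Y B => ?_, fun Y hY hYc => ?_⟩
    · have e1 : s (g • Y) = ⟨permRep (Finset α) g (s Y), permRep_mem_johnsonS Z _ hg (s Y).2⟩ :=
        Subtype.ext (permRep_kernelS hg Y).symm
      change M (s (g • Y)) (g • B) = _
      rw [e1, hMg g hg, permRep_apply, inv_smul_smul]
    · rw [← map_sum]
      have e1 : ∑ x ∈ Z \ Y, s (insert x Y) = 0 := by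
        apply Subtype.ext
        rw [Submodule.coe_sum]
        exact sum_kernelS_insert hY hYc
      rw [e1, map_zero]
  have hM0 : ∀ Y, M (s Y) = 0 := by
    intro Y
    by_cases hY : Y ⊆ Z ∧ Y.card = atRoot k
    · refine hfam.eq_zero hk hZ h1 hc2 hY₁Z hY₁c' hY₁G h2 h3 hV hV' ?_ Y hY.1 hY.2
      rw [joinLeaf_eta]
      have e1 : treeT (.node l r) a k Z (s Y₁) = treePsi (.node l r) a k Z Y₁ :=
        treeT_kernelS hk hY₁c'
      rw [hM, e1, Pi.sub_apply, Pi.smul_apply, Pi.smul_apply, treePsi_of_mem _ _ hB₁,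
        smul_eq_mul, smul_eq_mul]
      ring
    · have e1 : s Y = 0 := Subtype.ext (kernelS_eq_zero hY)
      rw [e1, map_zero]
  have hMz : ∀ u, M u = 0 := by
    intro u
    have e1 : u = ∑ Y, (u : Finset α → ℂ) Y • s Y := by
      apply Subtype.ext
      rw [Submodule.coe_sum]
      exact (sum_smul_kernelS u.2).symm
    rw [e1, map_sum]
    exact Finset.sum_eq_zero fun Y _ => by rw [map_smul, hM0, smul_zero]
  have hcL : ∀ u, c • L u = d • treeT (.node l r) a k Z u := fun u => sub_eq_zero.1 (hMz u)
  -- If `d = 0`, then `c • L = 0` and `e` is zero, although it is injective on a space containing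
  -- the nonzero vector `treeVec (.node l r) k B₁`.
  have hd : d ≠ 0 := by
    intro hd
    have hLz : ∀ u, e u = 0 := fun u => by
      have := hcL u
      rw [hd, zero_smul] at this
      exact Subtype.ext ((smul_eq_zero.1 this).resolve_left hV₁)
    have hv : (⟨treeVec (.node l r) k B₁, treeVec_mem hk hB₁⟩ : johnsonS Z (atRoot k)) = 0 :=
      e.injective ((hLz _).trans (map_zero e).symm)
    have h4 := congrFun (congrArg Subtype.val hv) Y₁
    change treeVec (.node l r) k B₁ Y₁ = 0 at h4
    rw [treeVec, if_pos (show Y₁.card = repRoot (.node l r) k from hY₁c')] at h4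
    exact hV₁ h4
  apply le_antisymm
  · intro f hf
    obtain ⟨u, hu⟩ := e.surjective ⟨f, hf⟩
    have h4 := hcL u
    rw [hL, hu] at h4
    rw [← Submodule.smul_mem_iff _ hV₁]
    change c • f ∈ _
    rw [show c • f = _ from h4]
    exact Submodule.smul_mem _ _ ⟨u, u.2, rfl⟩
  · rintro _ ⟨u, hu, rfl⟩
    rw [← Submodule.smul_mem_iff _ hd, ← hcL ⟨u, hu⟩]
    exact Submodule.smul_mem _ _ (e ⟨u, hu⟩).2

theorem induced_eq_treeInduced (hZ : Z.card = total a)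
    {V : Finset α → Submodule ℂ ((Leaf l → Finset α) → ℂ)}
    {V' : Finset α → Submodule ℂ ((Leaf r → Finset α) → ℂ)}
    (hV : ∀ F : Finset α, F.card = total (leafL a) → V F = treeR l (leafL a) (intL k) F)
    (hV' : ∀ F : Finset α, F.card = total (leafR a) → V' F = treeR r (leafR a) (intR k) F) :
    induced (total (leafL a)) V V' Z = treeInduced l r a k Z := by
  refine iSup_congr fun F => iSup_congr fun hF => ?_
  obtain ⟨hFZ, hFc⟩ := Finset.mem_powersetCard.1 hF
  rw [hV F hFc, hV' (Z \ F) (by rw [Finset.card_sdiff_of_subset hFZ, hZ, total_node]; omega)]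

theorem sSup_isCopy_eq_treeR (hk : IsRepLabeling (.node l r) a k) (hZ : Z.card = total a) :
    sSup {U | U ≤ treeInduced l r a k Z ∧ IsCopy Z (atRoot k) U} = treeR (.node l r) a k Z := by
  have h : IsCopy Z (atRoot k) (treeR (.node l r) a k Z) :=
    treeR_isCopy (T := .node l r) (a := a) (k := k) hk hZ
  exact le_antisymm (sSup_le fun U hU => (eq_treeR_of_isCopy hk hZ hU.1 hU.2).le)
    (le_sSup ⟨treeR_le_treeInduced hk, h⟩)

/-- Induction on the tree. At a leaf there is a single partition, and the constant function on it is
`Ψ` of the empty set. At a node the induced representations agree by induction, and the supremum of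
all copies is the one copy `treeR`. -/
theorem bracketS_eq_treeR {T : BTree} {a : Leaf T → ℕ} {k : Internal T → ℕ}
    (hk : IsRepLabeling T a k) (hZ : Z.card = total a) : bracketS T a k Z = treeR T a k Z := by
  induction T generalizing Z with
  | leaf =>
    refine le_antisymm (fun f hf => ?_) treeR_le_moduleM
    have hf' : f = f (fun _ => Z) • treePsi .leaf a k Z ∅ := by
      funext B
      by_cases hB : B ∈ OmegaA a Z
      · have hBZ : B = fun _ => Z := funext fun _ => (mem_OmegaA_leaf.1 hB).2
        rw [Pi.smul_apply, treePsi_of_mem _ _ hB, hBZ]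
        simp [treeV]
      · rw [Pi.smul_apply, treePsi_of_notMem _ _ hB, smul_zero]
        exact hf B hB
    rw [hf']
    exact Submodule.smul_mem _ _ (treePsi_mem_treeR hk (Finset.empty_subset Z))
  | node l r ihl ihr =>
    rw [bracketS, induced_eq_treeInduced hZ (fun F hF => ihl hk.2.2.2.2.2.1 hF)
      fun F hF => ihr hk.2.2.2.2.2.2 hF]
    exact sSup_isCopy_eq_treeR hk hZ

end Uniqueness

/-! ### Consecutive intervals -/

/-- The elements `x` of `{0, …, n-1}` with `s ≤ x < s + c`. -/
def interval (n s c : ℕ) : Finset (Fin n) :=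
  Finset.univ.filter fun x : Fin n => s ≤ x.val ∧ x.val < s + c

theorem card_interval {n s c : ℕ} (h : s + c ≤ n) : (interval n s c).card = c := by
  have e : (interval n s c).map Fin.valEmbedding = Finset.Ico s (s + c) := by
    ext x
    simp only [interval, Finset.mem_map, Finset.mem_filter, Finset.mem_univ, true_and,
      Fin.valEmbedding_apply, Finset.mem_Ico]
    exact ⟨fun ⟨y, hy, hyx⟩ => hyx ▸ hy, fun hx => ⟨⟨x, by omega⟩, hx, rfl⟩⟩
  rw [← Finset.card_map, e, Nat.card_Ico, Nat.add_sub_cancel_left]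

theorem intervals_mem_OmegaA (n : ℕ) (T : BTree) (a : Leaf T → ℕ) (s : ℕ)
    (h : s + total a ≤ n) : intervals n T a s ∈ OmegaA a (interval n s (total a)) := by
  induction T generalizing s with
  | leaf =>
    rw [total_leaf] at h ⊢
    exact mem_OmegaA_leaf.2 ⟨card_interval h, rfl⟩
  | node l r ihl ihr =>
    rw [total_node] at h ⊢
    have hF : interval n s (total (leafL a)) ⊆
        interval n s (total (leafL a) + total (leafR a)) := by
      intro x
      simp only [interval, Finset.mem_filter, Finset.mem_univ, true_and]
      omega
    have hG : interval n s (total (leafL a) + total (leafR a)) \ interval n s (total (leafL a)) =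
        interval n (s + total (leafL a)) (total (leafR a)) := by
      ext x
      simp only [interval, Finset.mem_sdiff, Finset.mem_filter, Finset.mem_univ, true_and]
      omega
    refine ((mem_OmegaA_node_iff hF).2 ⟨ihl (leafL a) s (by omega), ?_⟩).1
    rw [hG]
    exact ihr (leafR a) _ (by omega)

theorem card_firstY {n m : ℕ} (h : m ≤ n) : (firstY n m).card = m := by
  have e : firstY n m = interval n 0 m := by
    ext x
    simp [firstY, interval]
  rw [e, card_interval (by omega)]

/-! ### The functions of the statement in terms of strings -/

section Final

set_option linter.unusedSectionVars false

variable {α : Type} [Fintype α] [DecidableEq α]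

theorem Psi_eq_treePsi {T : BTree} {a : Leaf T → ℕ} {k : Internal T → ℕ}
    (hk : IsRepLabeling T a k) {Z Y : Finset α} (hY : Y ⊆ Z) :
    Psi T a k Y.card Z Y = treePsi T a k Z Y := by
  funext B
  rw [Psi_apply, Finset.inter_eq_left.2 hY]
  by_cases hB : B ∈ OmegaA a Z
  · rw [if_pos hB, treePsi_of_mem _ _ hB, Phi_eq_treeV T a k hk Z B hB, if_pos rfl]
  · rw [if_neg hB, treePsi_of_notMem _ _ hB]

theorem Phi_root_eq_treeVec {T : BTree} {a : Leaf T → ℕ} {k : Internal T → ℕ}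
    (hk : IsRepLabeling T a k) {Z : Finset α} {B : Leaf T → Finset α} (hB : B ∈ OmegaA a Z) :
    Phi T a k (repRoot T k) B = treeVec T k B :=
  funext fun X => Phi_eq_treeV T a k hk Z B hB _ X

end Final

end HahnTree

end

/-! ### The theorem on trees and intertwining functions -/

theorem mainTheorem6 (l r : BTree) (a : Leaf (.node l r) → ℕ) (ha : ∀ x, 0 < a x)
    (k : Internal (.node l r) → ℕ) (hk : IsRepLabeling (.node l r) a k)
    (n m : ℕ) (hn : total a = n) (hkm : atRoot k ≤ m) (hknm : atRoot k + m ≤ n)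
    (N Y : Finset (Fin n)) (hN : N = Finset.univ) (hY : Y = firstY n m)
    (A : Leaf (.node l r) → Finset (Fin n)) (hA : A = intervals n (.node l r) a 0) :
    -- the space `[S^{n-k,k}]` is the unique copy of `S^{n-k,k}` in the induced representation
    (bracketS (.node l r) a k N ≤
        induced (total (leafL a)) (bracketS l (leafL a) (intL k))
          (bracketS r (leafR a) (intR k)) N ∧
      IsCopy N (atRoot k) (bracketS (.node l r) a k N) ∧
      ∀ U : Submodule ℂ ((Leaf (.node l r) → Finset (Fin n)) → ℂ),
        U ≤ induced (total (leafL a)) (bracketS l (leafL a) (intL k))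
            (bracketS r (leafR a) (intR k)) N →
          IsCopy N (atRoot k) U → U = bracketS (.node l r) a k N) ∧
    -- `v = Φ(T(a), k, T_r(k))` is an `S_a`-invariant vector of `S^{n-k,k}`
    (Phi (.node l r) a k (atRoot k) A ∈ johnsonS N (atRoot k) ∧
      ∀ g : Equiv.Perm (Fin n), g • A = A →
        permRep (Finset (Fin n)) g (Phi (.node l r) a k (atRoot k) A) =
          Phi (.node l r) a k (atRoot k) A) ∧
    -- the operator `T_v` is well defined, and `T_v S^{n-k,k} = [S^{n-k,k}]`
    (∃ Tv : johnsonS N (atRoot k) →ₗ[ℂ] ((Leaf (.node l r) → Finset (Fin n)) → ℂ),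
      (∀ u, Tv u ∈ moduleM a N) ∧
      (∀ (u : johnsonS N (atRoot k)) (g : Equiv.Perm (Fin n)),
        Tv u (g • A) =
          herm u (permRep (Finset (Fin n)) g (Phi (.node l r) a k (atRoot k) A))) ∧
      LinearMap.range Tv = bracketS (.node l r) a k N) ∧
    -- `Ψ` corresponds to `Φ` under `g ↦ g⁻¹`
    (∀ g : Equiv.Perm (Fin n),
      Psi (.node l r) a k m N Y (g • A) = Phi (.node l r) a k m A (g⁻¹ • Y)) ∧
    -- `Ψ` is invariant under the stabilizer of `Y` and lies in `[S^{n-k,k}]`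
    (∀ g : Equiv.Perm (Fin n), g • Y = Y →
      permRep (Leaf (.node l r) → Finset (Fin n)) g (Psi (.node l r) a k m N Y) =
        Psi (.node l r) a k m N Y) ∧
    Psi (.node l r) a k m N Y ∈ bracketS (.node l r) a k N ∧
    -- `Ξ(w)` is supported on `Θ_w`
    (∀ w ∈ rootRange a k m, ∀ B : Leaf (.node l r) → Finset (Fin n),
      Xi l r a k m w N Y B ≠ 0 →
        B ∈ OmegaA a N ∧ (Finset.univ.biUnion (leafL B) ∩ Y).card = m - w) ∧
    -- the iterative formula
    Psi (.node l r) a k m N Y =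
      ∑ w ∈ rootRange a k m, rootCoeff a k m w • Xi l r a k m w N Y := by
  -- For `N` the whole set, the relative symmetric group is the full one, so all equivariance
  -- statements apply to every `g`.
  have hmem : ∀ g : Equiv.Perm (Fin n), g ∈ symOn N := fun g x hx => by
    rw [hN] at hx
    exact (hx (Finset.mem_univ x)).elim
  have hNc : N.card = total a := by rw [hN, Finset.card_univ, Fintype.card_fin, hn]
  have hAN : A ∈ OmegaA a N := by
    have h := intervals_mem_OmegaA n (.node l r) a 0 (by omega)
    have e : interval n 0 (total a) = N := by
      rw [hN]
      refine Finset.eq_univ_of_card _ ?_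
      rw [card_interval (by omega), Fintype.card_fin, hn]
    rwa [e, ← hA] at h
  have hgA : ∀ g : Equiv.Perm (Fin n), g • A ∈ OmegaA a N := fun g => by
    rw [← smul_eq_of_mem_symOn (hmem g)]
    exact (smul_mem_OmegaA g).2 hAN
  have hYN : Y ⊆ N := by rw [hN]; exact Finset.subset_univ Y
  have hYc : Y.card = m := by rw [hY, card_firstY (by omega)]
  have hPsi : Psi (.node l r) a k m N Y = treePsi (.node l r) a k N Y := by
    rw [← hYc]
    exact Psi_eq_treePsi hk hYN
  have hPhi : Phi (.node l r) a k (atRoot k) A = treeVec (.node l r) k A :=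
    Phi_root_eq_treeVec hk hAN
  have hInd : induced (total (leafL a)) (bracketS l (leafL a) (intL k))
      (bracketS r (leafR a) (intR k)) N = treeInduced l r a k N :=
    induced_eq_treeInduced hNc (fun F hF => bracketS_eq_treeR hk.2.2.2.2.2.1 hF)
      fun F hF => bracketS_eq_treeR hk.2.2.2.2.2.2 hF
  rw [hInd, bracketS_eq_treeR hk hNc, hPhi]
  refine ⟨⟨treeR_le_treeInduced hk, ?_, fun U hU hU' => eq_treeR_of_isCopy hk hNc hU hU'⟩,
    ⟨?_, fun g hg => ?_⟩, ?_, fun g => ?_, fun g hg => ?_, ?_, ?_,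
    Psi_eq_sum_Xi l r a k hk m N Y⟩
  · exact treeR_isCopy (T := .node l r) (a := a) (k := k) hk hNc
  · exact treeVec_mem (T := .node l r) (a := a) (k := k) hk hAN
  · rw [permRep_treeVec, hg]
  · refine ⟨(treeT (.node l r) a k N).domRestrict _, fun u => ?_, fun u g => ?_,
      LinearMap.range_domRestrict _ _⟩
    · exact treeR_le_moduleM ⟨u, u.2, rfl⟩
    · rw [permRep_treeVec]
      exact if_pos (hgA g)
  · rw [hPsi, treePsi_of_mem _ _ (hgA g), Phi_eq_treeV _ _ _ hk _ _ hAN,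
      Finset.card_smul_finset, if_pos hYc, ← treeV_smul _ k g⁻¹, inv_smul_smul]
  · rw [hPsi, permRep_treePsi (hmem g), hg]
  · rw [hPsi]
    exact treePsi_mem_treeR hk hYN
  · intro w _ B hB
    rw [Xi_apply] at hB
    by_contra h
    exact hB (if_neg h)
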